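/- Let $C/\mathbb{Q}$ be the affine curve in $\mathbb{A}^3$ defined by $$y^2 = 2(x^3+x^2-x+1),\qquad z^2=-2(x^3-x^2-x-1).$$ Then: 1. $C(\mathbb{Q})=\{(\pm1,\pm2,\pm2)\}$ (all eight choices of signs). 2. If $K$ is a quadratic field different from $\mathbb{Q}(\sqrt2)$ and $\mathbb{Q}(\sqrt{-7})$, then $C(K)=C(\mathbb{Q})$. 3. For $K=\mathbb{Q}(\sqrt2)$, $C(K)\setminus C(\mathbb{Q})=\{(0,\pm\sqrt2,\pm\sqrt2)\}$ (all four choices of signs). 4. For $K=\mathbb{Q}(\sqrt{-7})$, $C(K)\setminus C(\mathbb{Q})$ consists of the points $(x,\pm(2x-4),\pm(2x+4))$ with $x\in K$, $x^2+7=0$ (all choices of signs). For a field $K$ and $c\in K$ let $f_c(z)=z^2+c$, and let $G(f_c,K)$ be the directed graph whose vertices are the points of $K$ that are preperiodic for $f_c$, with an edge $x\to f_c(x)$ for each vertex $x$. Let $10(1,1)\mathrm{a}$ denote the directed graph with vertices $0,1,\dots,9$ and edges $$0\to0,\quad 1\to0,\quad 2\to1,\quad 3\to1,\quad 4\to2,\quad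 5\to2,\quad 6\to3,\quad 7\to3,\quad 8\to8,\quad 9\to8.$$ 5. Let $K$ be a quadratic field and let $c\in K$. If $G(f_c,K)$ contains a subgraph isomorphic to $10(1,1)\mathrm{a}$, then $c=3/16$ and $K=\mathbb{Q}(\sqrt{-7})$. -/

import Mathlib

open scoped IntermediateField

/-- The affine curve `C` given by `y² = 2(x³ + x² - x + 1)` and `z² = -2(x³ - x² - x - 1)`:
its set `C(K)` of points with coordinates in `K`. -/
def curveC (K : Type*) [Field K] : Set (K × K × K) :=
  {p | p.2.1 ^ 2 = 2 * (p.1 ^ 3 + p.1 ^ 2 - p.1 + 1) ∧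
       p.2.2 ^ 2 = -2 * (p.1 ^ 3 - p.1 ^ 2 - p.1 - 1)}

/-- `C(ℚ)`, regarded as a subset of `K × K × K`. -/
def rationalPointsC (K : Type*) [Field K] [Algebra ℚ K] : Set (K × K × K) :=
  (fun p : ℚ × ℚ × ℚ => (algebraMap ℚ K p.1, algebraMap ℚ K p.2.1, algebraMap ℚ K p.2.2)) ''
    curveC ℚ

/-- `K = ℚ(√d)`: the field `K` is generated over `ℚ` by a square root of `d`. -/
def IsRatAdjoinSqrt (d : ℚ) (K : Type*) [Field K] [Algebra ℚ K] : Prop :=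
  ∃ s : K, s ^ 2 = algebraMap ℚ K d ∧ ℚ⟮s⟯ = ⊤

/-- The quadratic polynomial map `f_c(z) = z² + c` on `K`. -/
def quadMap {K : Type*} [Field K] (c : K) : K → K := fun z => z ^ 2 + c

/-- A point is preperiodic if some iterate of it is periodic. -/
def IsPreperiodicPt {α : Type*} (f : α → α) (x : α) : Prop :=
  ∃ n : ℕ, f^[n] x ∈ Function.periodicPts f

/-- The directed graph `G(f, K)`: vertices are the preperiodic points of `f` in `K`,
with one edge from each vertex `x` to `f x`. -/
def preperiodicGraph {K : Type*} (f : K → K) : Digraph {x : K // IsPreperiodicPt f x} where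
  Adj x y := f x = y

/-- `G` contains a (not necessarily induced) subgraph isomorphic to `H`. -/
def Digraph.ContainsCopy {V W : Type*} (G : Digraph V) (H : Digraph W) : Prop :=
  ∃ φ : W → V, Function.Injective φ ∧ ∀ u v, H.Adj u v → G.Adj (φ u) (φ v)

/-- The directed graph of type 10(1,1)a, on the vertices `0, …, 9`. Its edges are
`0 → 0`, `1 → 0`, `2 → 1`, `3 → 1`, `4 → 2`, `5 → 2`, `6 → 3`, `7 → 3`, `8 → 8`, `9 → 8`. -/
def graph10_11a : Digraph (Fin 10) where
  Adj i j := j = (![0, 0, 1, 1, 2, 2, 3, 3, 8, 8] : Fin 10 → Fin 10) i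

/-! The curve `C` maps to three elliptic curves over ℚ. Forgetting `z`, or forgetting `y` and
replacing `x` by `-x`, gives `E : y² = 2(x³ + x² - x + 1)`. The product `w = yz/2` satisfies `w² =
-x⁶ + 3x⁴ + x² + 1`, which covers `E' : Y² = X³ + X² + 3X - 1` through `X = 1/x²`. The affine
rational points have `x = ±1` on `E` (a group of order 5) and `X = 1` on `E'` (a group of order 3).

Both groups are found by one 2-descent. The two cubics define the same field `ℚ(α)`, `α³ + α² - α +
1 = 0`, of class number one, whose units modulo squares are generated by `-1` and `α`. If `β` is a
root of the monic cubic, then `X - β` at a rational point is a square or `-α` times a square: the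
only other primes that could intervene lie over 2 and 11, and norms rule them out. A 2-adic descent
excludes `-α`, so every point is a double (`exists_half_of_conductor_eleven`,
`exists_half_of_conductor_forty_four`). Doubling roughly raises the height of `x` to the fourth
power, so halving repeatedly ends in a box that is searched exhaustively (`height_descent`).

Over a quadratic field, take a point of `C` with irrational `x`. The line through the corresponding
point of `E` and its conjugate meets `E` in a third, rational point, so `x` is a root of one of two
one-parameter families of quadratics. Applying this to `(x, y)` and to `(-x, z)` and comparing
coefficients leaves `x² = -7`. If `x` is rational, then `y`, `z` or `yz` is rational, which gives a
rational point on `E` or on the sextic. For the graph, the ratio of the two preimage levels above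
the fixed point is the `x`-coordinate of a point of `C`. -/

open Module NumberField

/-! ### Coordinates, norm and trace in the cubic field ℚ(α) -/

section Coordinates

variable {K : Type*} [Field K] [NumberField K] {α : K}

theorem basis_sum_coords {b : Basis (Fin 3) ℚ K} (hb : ∀ i, b i = α ^ (i : ℕ)) (c : Fin 3 → ℚ) :
    ∑ i, c i • b i = (c 0 : K) + c 1 * α + c 2 * α ^ 2 := by
  simp [Fin.sum_univ_three, hb, Algebra.smul_def]

theorem exists_coords {b : Basis (Fin 3) ℚ K} (hb : ∀ i, b i = α ^ (i : ℕ)) (γ : K) :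
    ∃ u v w : ℚ, γ = u + v * α + w * α ^ 2 :=
  ⟨b.repr γ 0, b.repr γ 1, b.repr γ 2, by rw [← basis_sum_coords hb, b.sum_repr]⟩

theorem repr_coords {b : Basis (Fin 3) ℚ K} (hb : ∀ i, b i = α ^ (i : ℕ)) (u v w : ℚ) :
    ⇑(b.repr (u + v * α + w * α ^ 2)) = ![u, v, w] := by
  have h := basis_sum_coords hb ![u, v, w]
  simp only [Matrix.cons_val_zero, Matrix.cons_val_one, Matrix.cons_val] at h
  rw [← h, b.repr_sum_self]

theorem coords_inj {b : Basis (Fin 3) ℚ K} (hb : ∀ i, b i = α ^ (i : ℕ)) {u v w u' v' w' : ℚ}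
    (h : (u : K) + v * α + w * α ^ 2 = u' + v' * α + w' * α ^ 2) : u = u' ∧ v = v' ∧ w = w' := by
  have := repr_coords hb u v w
  rw [h, repr_coords hb] at this
  exact ⟨(congrFun this 0).symm, (congrFun this 1).symm, (congrFun this 2).symm⟩

theorem leftMulMatrix_coords (hα : α ^ 3 = -α ^ 2 + α - 1)
    {b : Basis (Fin 3) ℚ K} (hb : ∀ i, b i = α ^ (i : ℕ)) (u v w : ℚ) :
    Algebra.leftMulMatrix b (u + v * α + w * α ^ 2) =
      !![u, -w, w - v; v, u + w, v - 2 * w; w, v - w, u - v + 2 * w] := by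
  have h0 : ((u : K) + v * α + w * α ^ 2) * b 0 = u + v * α + w * α ^ 2 := by simp [hb]
  have h1 : ((u : K) + v * α + w * α ^ 2) * b 1 =
      ((-w : ℚ) : K) + ((u + w : ℚ) : K) * α + ((v - w : ℚ) : K) * α ^ 2 := by
    simp only [hb]; push_cast; simp only [Fin.val_one, pow_one]; linear_combination (w : K) * hα
  have h2 : ((u : K) + v * α + w * α ^ 2) * b 2 =
      ((w - v : ℚ) : K) + ((v - 2 * w : ℚ) : K) * α + ((u - v + 2 * w : ℚ) : K) * α ^ 2 := by
    simp only [hb]; push_cast; simp only [Fin.val_two]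
    linear_combination ((w : K) * α + v - w) * hα
  ext i j
  rw [Algebra.leftMulMatrix_eq_repr_mul]
  fin_cases j
  · simp only [Fin.zero_eta, h0, repr_coords hb]; fin_cases i <;> simp
  · simp only [Fin.mk_one, h1, repr_coords hb]; fin_cases i <;> simp
  · simp only [Fin.reduceFinMk, h2, repr_coords hb]; fin_cases i <;> simp

theorem norm_coords (hα : α ^ 3 = -α ^ 2 + α - 1)
    {b : Basis (Fin 3) ℚ K} (hb : ∀ i, b i = α ^ (i : ℕ)) (u v w : ℚ) :
    Algebra.norm ℚ ((u : K) + v * α + w * α ^ 2) =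
      u * ((u + w) * (u - v + 2 * w) - (v - 2 * w) * (v - w)) +
      w * (v * (u - v + 2 * w) - (v - 2 * w) * w) + (w - v) * (v * (v - w) - (u + w) * w) := by
  rw [Algebra.norm_eq_matrix_det b, leftMulMatrix_coords hα hb, Matrix.det_fin_three]
  simp; ring

theorem trace_coords (hα : α ^ 3 = -α ^ 2 + α - 1)
    {b : Basis (Fin 3) ℚ K} (hb : ∀ i, b i = α ^ (i : ℕ)) (u v w : ℚ) :
    Algebra.trace ℚ K ((u : K) + v * α + w * α ^ 2) = 3 * u - v + 3 * w := by
  rw [Algebra.trace_eq_matrix_trace b, leftMulMatrix_coords hα hb, Matrix.trace_fin_three]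
  simp; ring

theorem discr_basis_eq (hα : α ^ 3 = -α ^ 2 + α - 1)
    {b : Basis (Fin 3) ℚ K} (hb : ∀ i, b i = α ^ (i : ℕ)) : Algebra.discr ℚ b = -44 := by
  have t : ∀ (m n : ℕ) (u v w d : ℚ), α ^ (m + n) = u + v * α + w * α ^ 2 →
      3 * u - v + 3 * w = d → Algebra.trace ℚ K (α ^ m * α ^ n) = d := by
    rintro m n u v w d h rfl
    rw [← pow_add, h, trace_coords hα hb]
  have h3 : α ^ 3 = ((-1 : ℚ) : K) + ((1 : ℚ) : K) * α + ((-1 : ℚ) : K) * α ^ 2 := by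
    push_cast; linear_combination hα
  have h4 : α ^ 4 = ((1 : ℚ) : K) + ((-2 : ℚ) : K) * α + ((2 : ℚ) : K) * α ^ 2 := by
    push_cast; linear_combination (α - 1) * hα
  have key : ∀ i j, Algebra.traceMatrix ℚ b i j = !![3, -1, 3; -1, 3, -7; 3, -7, (11 : ℚ)] i j := by
    intro i j
    rw [Algebra.traceMatrix_apply, Algebra.traceForm_apply, hb, hb]
    fin_cases i <;> fin_cases j
    · exact t 0 0 1 0 0 3 (by simp) (by norm_num)
    · exact t 0 1 0 1 0 (-1) (by simp) (by norm_num)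
    · exact t 0 2 0 0 1 3 (by simp) (by norm_num)
    · exact t 1 0 0 1 0 (-1) (by simp) (by norm_num)
    · exact t 1 1 0 0 1 3 (by simp) (by norm_num)
    · exact t 1 2 _ _ _ (-7) h3 (by norm_num)
    · exact t 2 0 0 0 1 3 (by simp) (by norm_num)
    · exact t 2 1 _ _ _ (-7) h3 (by norm_num)
    · exact t 2 2 _ _ _ 11 h4 (by norm_num)
  have : Algebra.traceMatrix ℚ b = !![3, -1, 3; -1, 3, -7; 3, -7, (11 : ℚ)] :=
    Matrix.ext key
  rw [Algebra.discr_def, this, Matrix.det_fin_three]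
  simp; norm_num

end Coordinates

/-! ### Class number and units of ℚ(α) -/

section Arithmetic

variable {K : Type*} [Field K] [NumberField K] {α : K}

omit [NumberField K] in
theorem isIntegral_root (hα : α ^ 3 = -α ^ 2 + α - 1) : IsIntegral ℤ α :=
  ⟨.X ^ 3 + .X ^ 2 - .X + 1, by monicity!, by simp [hα]; ring⟩

/-- The integer `n` is the determinant expressing `1, α, α²` in an integral basis. Only the sign and
the bound `|discr K| ≤ 44` are extracted from this, so it need not be known whether `α` generates
the ring of integers. -/
theorem exists_sq_mul_discr (hα : α ^ 3 = -α ^ 2 + α - 1)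
    {b : Basis (Fin 3) ℚ K} (hb : ∀ i, b i = α ^ (i : ℕ)) :
    ∃ n : ℤ, n ^ 2 * discr K = -44 := by
  classical
  have hbint : ∀ i, IsIntegral ℤ (b i) := fun i => by rw [hb]; exact (isIntegral_root hα).pow _
  let β : Fin 3 → 𝓞 K := fun i => ⟨b i, hbint i⟩
  have e : Free.ChooseBasisIndex ℤ (𝓞 K) ≃ Fin 3 := by
    refine Fintype.equivOfCardEq ?_
    rw [← finrank_eq_card_basis (integralBasis K), finrank_eq_card_basis b]
  let c := (RingOfIntegers.basis K).reindex e
  refine ⟨(c.toMatrix β).det, ?_⟩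
  rw [← discr_eq_discr K c, ← Algebra.discr_of_matrix_vecMul, Basis.toMatrix_map_vecMul]
  have h : (Algebra.traceMatrix ℤ β).map (Int.castRingHom ℚ) = Algebra.traceMatrix ℚ b := by
    ext i j
    simp only [Matrix.map_apply, Algebra.traceMatrix_apply, Algebra.traceForm_apply]
    exact Algebra.coe_trace_int _
  have h2 := discr_basis_eq hα hb
  rw [Algebra.discr_def, ← h, ← RingHom.mapMatrix_apply, ← RingHom.map_det] at h2
  rw [Algebra.discr_def]
  rw [eq_intCast] at h2
  exact_mod_cast h2

theorem nrComplexPlaces_eq_one (hα : α ^ 3 = -α ^ 2 + α - 1)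
    {b : Basis (Fin 3) ℚ K} (hb : ∀ i, b i = α ^ (i : ℕ)) :
    InfinitePlace.nrComplexPlaces K = 1 := by
  obtain ⟨n, hn⟩ := exists_sq_mul_discr hα hb
  have h1 := sign_discr K
  have h2 := InfinitePlace.card_add_two_mul_card_eq_rank K
  rw [finrank_eq_card_basis b, Fintype.card_fin] at h2
  have hneg : discr K < 0 := by nlinarith [sq_nonneg n]
  rw [Int.sign_eq_neg_one_of_neg hneg] at h1
  have : InfinitePlace.nrComplexPlaces K ≠ 0 := fun h => by simp [h] at h1
  omega

/-- Minkowski's bound, with one complex place: `44 < (2 · (π/4) · 3³/3!)² = (9π/4)² ≈ 49.9`. -/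
theorem isPrincipalIdealRing_integers (hα : α ^ 3 = -α ^ 2 + α - 1)
    {b : Basis (Fin 3) ℚ K} (hb : ∀ i, b i = α ^ (i : ℕ)) : IsPrincipalIdealRing (𝓞 K) := by
  apply RingOfIntegers.isPrincipalIdealRing_of_abs_discr_lt
  obtain ⟨n, hn⟩ := exists_sq_mul_discr hα hb
  have hneg : discr K < 0 := by nlinarith [sq_nonneg n]
  have hn0 : 1 ≤ n ^ 2 := by
    have : n ≠ 0 := by rintro rfl; simp at hn
    have := sq_pos_of_ne_zero this
    omega
  have habs : |discr K| ≤ 44 := by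
    rw [abs_of_neg hneg]; nlinarith
  rw [nrComplexPlaces_eq_one hα hb, finrank_eq_card_basis b, Fintype.card_fin]
  have h3 : ((3 : ℕ).factorial : ℝ) = 6 := by norm_num [Nat.factorial]
  rw [h3]
  have hpi := Real.pi_gt_d2
  have h4 : ((|discr K| : ℤ) : ℝ) ≤ 44 := by exact_mod_cast habs
  refine h4.trans_lt ?_
  norm_num
  nlinarith

/-- One real and one complex place give unit rank 1, and an odd degree leaves only the roots of
unity `±1`. -/
theorem units_eq_zpow (hα : α ^ 3 = -α ^ 2 + α - 1)
    {b : Basis (Fin 3) ℚ K} (hb : ∀ i, b i = α ^ (i : ℕ)) :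
    ∃ η : (𝓞 K)ˣ, ∀ ε : (𝓞 K)ˣ, ∃ k : ℤ, ε = η ^ k ∨ ε = -η ^ k := by
  have h2 := InfinitePlace.card_add_two_mul_card_eq_rank K
  have h3 := nrComplexPlaces_eq_one hα hb
  have hf : finrank ℚ K = 3 := by rw [finrank_eq_card_basis b, Fintype.card_fin]
  have hr : Units.rank K = 1 := by
    have := InfinitePlace.card_eq_nrRealPlaces_add_nrComplexPlaces K
    rw [Units.rank]; omega
  let i : Fin (Units.rank K) := ⟨0, by omega⟩
  have hu : ∀ j, j = i := fun j => by ext; simp [i]; omega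
  refine ⟨Units.fundSystem K i, fun ε => ?_⟩
  obtain ⟨⟨ζ, f⟩, h, -⟩ := Units.exist_unique_eq_mul_prod K ε
  refine ⟨f i, ?_⟩
  have hp : ∏ j, (Units.fundSystem K j) ^ (f j) = Units.fundSystem K i ^ f i :=
    Fintype.prod_eq_single i fun j hj => absurd (hu j) hj
  simp only [hp] at h
  rcases Units.torsion_eq_one_or_neg_one_of_odd_finrank (by rw [hf]; decide) ζ with hz | hz
  · left; rw [h, hz, one_mul]
  · right; rw [h, hz, neg_one_mul]

end Arithmetic

/-! ### 2-adic obstructions -/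

/-- Infinite descent on `|e|`, for homogeneous systems whose integral solutions must all be even. -/
theorem eq_zero_of_two_descent {P : ℤ → ℤ → ℤ → ℤ → Prop}
    (heven : ∀ u v w e, P u v w e → 2 ∣ u ∧ 2 ∣ v ∧ 2 ∣ w ∧ 2 ∣ e)
    (hhalf : ∀ u v w e, P (2 * u) (2 * v) (2 * w) (2 * e) → P u v w e) :
    ∀ u v w e, P u v w e → e = 0 := by
  have key : ∀ n : ℕ, ∀ u v w e, P u v w e → e.natAbs = n → e = 0 := by
    intro n
    induction n using Nat.strong_induction_on with
    | _ n ih =>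
      intro u v w e h hn
      obtain ⟨⟨u, rfl⟩, ⟨v, rfl⟩, ⟨w, rfl⟩, ⟨e, rfl⟩⟩ := heven u v w e h
      by_contra he
      have := ih e.natAbs (by omega) u v w e (hhalf _ _ _ _ h) rfl
      exact he (by rw [this, mul_zero])
  exact fun u v w e h => key _ u v w e h rfl

theorem exists_common_denom (u v w : ℚ) :
    ∃ D u' v' w' : ℤ, D ≠ 0 ∧ u = u' / D ∧ v = v' / D ∧ w = w' / D := by
  have hu := Rat.num_div_den u
  have hv := Rat.num_div_den v
  have hw := Rat.num_div_den w
  have h1 : (u.den : ℚ) ≠ 0 := by exact_mod_cast u.den_ne_zero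
  have h2 : (v.den : ℚ) ≠ 0 := by exact_mod_cast v.den_ne_zero
  have h3 : (w.den : ℚ) ≠ 0 := by exact_mod_cast w.den_ne_zero
  refine ⟨u.den * v.den * w.den, u.num * v.den * w.den, u.den * v.num * w.den,
    u.den * v.den * w.num, ?_, ?_, ?_, ?_⟩
  · exact_mod_cast mul_ne_zero (mul_ne_zero h1 h2) h3
  · push_cast; rw [eq_div_iff (by positivity)]; nth_rw 1 [← hu]; field_simp
  · push_cast; rw [eq_div_iff (by positivity)]; nth_rw 1 [← hv]; field_simp
  · push_cast; rw [eq_div_iff (by positivity)]; nth_rw 1 [← hw]; field_simp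

theorem two_dvd_of_four_mul_eq_zero {u : ℤ} (h : 4 * (u : ZMod 8) = 0) : 2 ∣ u := by
  have : ((4 * u : ℤ) : ZMod 8) = 0 := by push_cast; exact h
  rw [ZMod.intCast_zmod_eq_zero_iff_dvd] at this
  omega

/-- The hypotheses are the coordinates of `γ² = -α` for `γ = u + vα + wα²`. -/
theorem no_solution_tribonacci_sq (u v w : ℚ) (h0 : u ^ 2 - 2 * v * w + w ^ 2 = 0)
    (h1 : 2 * u * v + 2 * v * w - 2 * w ^ 2 = -1)
    (h2 : v ^ 2 + 2 * u * w - 2 * v * w + 2 * w ^ 2 = 0) : False := by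
  obtain ⟨D, u, v, w, hD, rfl, rfl, rfl⟩ := exists_common_denom u v w
  have hD' : (D : ℚ) ≠ 0 := by exact_mod_cast hD
  field_simp at h0 h1 h2
  norm_cast at h0 h1 h2
  refine hD (eq_zero_of_two_descent (P := fun u v w e => u ^ 2 - 2 * v * w + w ^ 2 = 0 ∧
    2 * u * v + 2 * v * w - 2 * w ^ 2 = -e ^ 2 ∧ v ^ 2 + 2 * u * w - 2 * v * w + 2 * w ^ 2 = 0)
    ?_ ?_ u v w D ⟨by linarith, by linarith, by linarith⟩)
  · rintro u v w e ⟨h0, h1, h2⟩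
    -- In ℤ/8, the condition `4u = 0` says that `u` is even.
    have key : ∀ u v w e : ZMod 8, u ^ 2 - 2 * v * w + w ^ 2 = 0 →
      2 * u * v + 2 * v * w - 2 * w ^ 2 = -e ^ 2 → v ^ 2 + 2 * u * w - 2 * v * w + 2 * w ^ 2 = 0 →
      4 * u = 0 ∧ 4 * v = 0 ∧ 4 * w = 0 ∧ 4 * e = 0 := by decide +kernel
    obtain ⟨a, b, c, d⟩ := key u v w e (by exact_mod_cast congrArg (Int.cast : ℤ → ZMod 8) h0)
      (by exact_mod_cast congrArg (Int.cast : ℤ → ZMod 8) h1)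
      (by exact_mod_cast congrArg (Int.cast : ℤ → ZMod 8) h2)
    exact ⟨two_dvd_of_four_mul_eq_zero a, two_dvd_of_four_mul_eq_zero b,
      two_dvd_of_four_mul_eq_zero c, two_dvd_of_four_mul_eq_zero d⟩
  · rintro u v w e ⟨h0, h1, h2⟩
    exact ⟨by linarith, by linarith, by linarith⟩

/-- The hypotheses are the `α²` and `α` coordinates of `-αγ² = a - 2αe²`; the constant coordinate,
which contains `a`, is not needed. -/
theorem no_solution_twisted_double (u v w : ℚ) (e : ℤ) (he : e ≠ 0)
    (h1 : v ^ 2 + 2 * u * w - 4 * v * w + 4 * w ^ 2 - 2 * u * v = 0)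
    (h2 : u ^ 2 - 4 * v * w + 3 * w ^ 2 + v ^ 2 + 2 * u * w = 2 * e ^ 2) : False := by
  obtain ⟨D, u, v, w, hD, rfl, rfl, rfl⟩ := exists_common_denom u v w
  have hD' : (D : ℚ) ≠ 0 := by exact_mod_cast hD
  field_simp at h1 h2
  norm_cast at h1 h2
  refine mul_ne_zero hD he (eq_zero_of_two_descent (P := fun u v w e =>
    v ^ 2 + 2 * u * w - 4 * v * w + 4 * w ^ 2 - 2 * u * v = 0 ∧
    u ^ 2 - 4 * v * w + 3 * w ^ 2 + v ^ 2 + 2 * u * w = 2 * e ^ 2)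
    ?_ ?_ u v w (D * e) ⟨by linarith, by linarith⟩)
  · rintro u v w e ⟨h1, h2⟩
    have key : ∀ u v w e : ZMod 8, v ^ 2 + 2 * u * w - 4 * v * w + 4 * w ^ 2 - 2 * u * v = 0 →
      u ^ 2 - 4 * v * w + 3 * w ^ 2 + v ^ 2 + 2 * u * w = 2 * e ^ 2 →
      4 * u = 0 ∧ 4 * v = 0 ∧ 4 * w = 0 ∧ 4 * e = 0 := by decide +kernel
    obtain ⟨a, b, c, d⟩ := key u v w e (by exact_mod_cast congrArg (Int.cast : ℤ → ZMod 8) h1)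
      (by exact_mod_cast congrArg (Int.cast : ℤ → ZMod 8) h2)
    exact ⟨two_dvd_of_four_mul_eq_zero a, two_dvd_of_four_mul_eq_zero b,
      two_dvd_of_four_mul_eq_zero c, two_dvd_of_four_mul_eq_zero d⟩
  · rintro u v w e ⟨h1, h2⟩
    exact ⟨by linarith, by linarith⟩

/-- The same two coordinates for `-αγ² = a - α⁻²e²`, where `α⁻² = -α² - 2α`. -/
theorem no_solution_twisted_inv_sq (u v w : ℚ) (e : ℤ) (he : e ≠ 0)
    (h1 : v ^ 2 + 2 * u * w - 4 * v * w + 4 * w ^ 2 - 2 * u * v = e ^ 2)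
    (h2 : u ^ 2 - 4 * v * w + 3 * w ^ 2 + v ^ 2 + 2 * u * w = -2 * e ^ 2) : False := by
  obtain ⟨D, u, v, w, hD, rfl, rfl, rfl⟩ := exists_common_denom u v w
  have hD' : (D : ℚ) ≠ 0 := by exact_mod_cast hD
  field_simp at h1 h2
  norm_cast at h1 h2
  refine mul_ne_zero hD he (eq_zero_of_two_descent (P := fun u v w e =>
    v ^ 2 + 2 * u * w - 4 * v * w + 4 * w ^ 2 - 2 * u * v = e ^ 2 ∧
    u ^ 2 - 4 * v * w + 3 * w ^ 2 + v ^ 2 + 2 * u * w = -2 * e ^ 2)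
    ?_ ?_ u v w (D * e) ⟨by linarith, by linarith⟩)
  · rintro u v w e ⟨h1, h2⟩
    have key : ∀ u v w e : ZMod 8, v ^ 2 + 2 * u * w - 4 * v * w + 4 * w ^ 2 - 2 * u * v = e ^ 2 →
      u ^ 2 - 4 * v * w + 3 * w ^ 2 + v ^ 2 + 2 * u * w = -2 * e ^ 2 →
      4 * u = 0 ∧ 4 * v = 0 ∧ 4 * w = 0 ∧ 4 * e = 0 := by decide +kernel
    obtain ⟨a, b, c, d⟩ := key u v w e (by exact_mod_cast congrArg (Int.cast : ℤ → ZMod 8) h1)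
      (by exact_mod_cast congrArg (Int.cast : ℤ → ZMod 8) h2)
    exact ⟨two_dvd_of_four_mul_eq_zero a, two_dvd_of_four_mul_eq_zero b,
      two_dvd_of_four_mul_eq_zero c, two_dvd_of_four_mul_eq_zero d⟩
  · rintro u v w e ⟨h1, h2⟩
    exact ⟨by linarith, by linarith⟩

/-! ### Square classes in ℚ(α) -/

theorem exists_eq_unit_mul_mul_sq {R : Type*} [CommRing R] [IsDomain R] [IsPrincipalIdealRing R]
    {A G c : R} (hA : A ≠ 0) (h : A * G = c ^ 2) :
    ∃ (d t : R) (u : Rˣ), d ∣ A ∧ d ∣ G ∧ A = u * d * t ^ 2 := by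
  classical
  let _ := IsBezout.toGCDDomain R
  obtain ⟨A', G', hA', hG', hcop⟩ := extract_gcd A G
  have hd : gcd A G ≠ 0 := fun h0 => hA ((gcd_eq_zero_iff _ _).1 h0).1
  have hdc : gcd A G ∣ c := by
    rw [← UniqueFactorizationMonoid.pow_dvd_pow_iff_dvd (two_ne_zero), ← h, sq]
    exact mul_dvd_mul (gcd_dvd_left A G) (gcd_dvd_right A G)
  obtain ⟨c', hc'⟩ := hdc
  have h2 : A' * G' = c' ^ 2 := by
    apply mul_left_cancel₀ (pow_ne_zero 2 hd)
    calc gcd A G ^ 2 * (A' * G') = (gcd A G * A') * (gcd A G * G') := by ring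
      _ = c ^ 2 := by rw [← hA', ← hG', h]
      _ = gcd A G ^ 2 * c' ^ 2 := by rw [← mul_pow, ← hc']
  obtain ⟨t, u, hu⟩ := exists_associated_pow_of_mul_eq_pow hcop h2
  exact ⟨gcd A G, t, u, gcd_dvd_left A G, gcd_dvd_right A G, by
    nth_rw 1 [hA']; rw [← hu]; ring⟩

section SquareClass

variable {K : Type*} [Field K] [NumberField K] {α : K}

theorem sq_coords (hα : α ^ 3 = -α ^ 2 + α - 1) (u v w : ℚ) :
    ((u : K) + v * α + w * α ^ 2) ^ 2 = ((u ^ 2 - 2 * v * w + w ^ 2 : ℚ) : K) +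
      ((2 * u * v + 2 * v * w - 2 * w ^ 2 : ℚ) : K) * α +
      ((v ^ 2 + 2 * u * w - 2 * v * w + 2 * w ^ 2 : ℚ) : K) * α ^ 2 := by
  push_cast
  linear_combination (2 * v * w + w ^ 2 * (α - 1) : K) * hα

theorem neg_root_mul_sq_coords (hα : α ^ 3 = -α ^ 2 + α - 1) (u v w : ℚ) :
    -α * ((u : K) + v * α + w * α ^ 2) ^ 2 =
      ((v ^ 2 + 2 * u * w - 2 * v * w + 2 * w ^ 2 : ℚ) : K) +
      ((-(u ^ 2 - 4 * v * w + 3 * w ^ 2 + v ^ 2 + 2 * u * w) : ℚ) : K) * α +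
      ((v ^ 2 + 2 * u * w - 4 * v * w + 4 * w ^ 2 - 2 * u * v : ℚ) : K) * α ^ 2 := by
  rw [sq_coords hα]
  push_cast
  linear_combination (-(v ^ 2 + 2 * u * w - 2 * v * w + 2 * w ^ 2) : K) * hα

theorem neg_root_ne_sq (hα : α ^ 3 = -α ^ 2 + α - 1)
    {b : Basis (Fin 3) ℚ K} (hb : ∀ i, b i = α ^ (i : ℕ)) (γ : K) : -α ≠ γ ^ 2 := by
  intro h
  obtain ⟨u, v, w, rfl⟩ := exists_coords hb γ
  rw [sq_coords hα] at h
  have h' : ((0 : ℚ) : K) + ((-1 : ℚ) : K) * α + ((0 : ℚ) : K) * α ^ 2 = _ :=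
    Eq.trans (by push_cast; ring) h
  obtain ⟨h0, h1, h2⟩ := coords_inj hb h'
  exact no_solution_tribonacci_sq u v w h0.symm h1.symm h2.symm

end SquareClass

/-- `N` is a quotient of squares, hence a square; since 11 occurs only once in the bound, it cannot
divide `N`. -/
theorem exists_even_pow_of_sq_dvd {N t c m : ℕ} (ht : t ≠ 0) (h : N * t ^ 2 = c ^ 2)
    (hN : N ∣ 2 ^ m * 11) : ∃ j, N = 2 ^ (2 * j) := by
  have htc : t ∣ c := by
    rw [← Nat.pow_dvd_pow_iff two_ne_zero]; exact Dvd.intro_left N h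
  obtain ⟨s, rfl⟩ := htc
  have hs : N = s ^ 2 := by
    have : t ^ 2 ≠ 0 := pow_ne_zero 2 ht
    apply Nat.eq_of_mul_eq_mul_right (Nat.pos_of_ne_zero this)
    rw [h]; ring
  subst hs
  have h11 : ¬ 11 ∣ s := by
    rintro ⟨k, rfl⟩
    have h1 : 11 * (11 * k ^ 2) ∣ 11 * 2 ^ m := by
      convert hN using 1 <;> ring
    have h2 : 11 ∣ 2 ^ m := (Dvd.intro _ rfl).trans (Nat.dvd_of_mul_dvd_mul_left (by norm_num) h1)
    have := (by norm_num : Nat.Prime 11).dvd_of_dvd_pow h2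
    omega
  have hcop : Nat.Coprime (s ^ 2) 11 :=
    (((by norm_num : Nat.Prime 11).coprime_iff_not_dvd.2 h11).symm).pow_left 2
  have h3 : s ∣ 2 ^ m := (dvd_pow_self s two_ne_zero).trans (hcop.dvd_of_dvd_mul_right hN)
  obtain ⟨j, -, rfl⟩ := (Nat.dvd_prime_pow Nat.prime_two).1 h3
  exact ⟨j, by rw [← pow_mul, mul_comm]⟩

section SquareClass

theorem norm_unit_natAbs {K : Type*} [Field K] (u : (𝓞 K)ˣ) : (Algebra.norm ℤ (u : 𝓞 K)).natAbs = 1 :=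
  Int.isUnit_iff_natAbs_eq.1 (u.isUnit.map (Algebra.norm ℤ))

variable {K : Type*} [Field K] [NumberField K] {α : K}

/-- Modulo squares the units are generated by `-1` and `η`. Since `α = ±η ^ j` with `j` odd, `α` can
take the place of `η`. -/
theorem exists_units_eq_zpow_mul_sq (hα : α ^ 3 = -α ^ 2 + α - 1)
    {b : Basis (Fin 3) ℚ K} (hb : ∀ i, b i = α ^ (i : ℕ)) (u : (𝓞 K)ˣ) :
    ∃ μ : (𝓞 K)ˣ, (u : K) = μ ^ 2 ∨ (u : K) = -μ ^ 2 ∨ (u : K) = -α * μ ^ 2 ∨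
      (u : K) = α * μ ^ 2 := by
  obtain ⟨η, hη⟩ := units_eq_zpow hα hb
  let a : 𝓞 K := ⟨α, isIntegral_root hα⟩
  have hav : a * -(a ^ 2 + a - 1) = 1 := by
    apply RingOfIntegers.coe_injective
    change α * -(α ^ 2 + α - 1) = 1
    linear_combination -hα
  let τ : (𝓞 K)ˣ := ⟨a, -(a ^ 2 + a - 1), hav, by rw [mul_comm]; exact hav⟩
  have hτ : (τ : K) = α := rfl
  have hnorm : Algebra.norm ℚ α = -1 := by
    have := norm_coords hα hb 0 1 0
    norm_num at this; exact this
  obtain ⟨j, hj⟩ := hη τ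
  have hcoe : ∀ k : ℤ, ((η ^ k : (𝓞 K)ˣ) : K) = (η : K) ^ k := fun k => by
    exact NumberField.Units.coe_zpow η k
  -- An even `j` would make `α` or `-α` a square; the former contradicts the norm `-1` of `α`, the
  -- latter `neg_root_ne_sq`.
  have hodd : Odd j := by
    by_contra hj'
    rw [Int.not_odd_iff_even] at hj'
    obtain ⟨i, rfl⟩ := hj'
    have h1 : (η : K) ^ (i + i) = ((η : K) ^ i) ^ 2 := by
      rw [zpow_add₀ (Units.coe_ne_zero η), sq]
    rcases hj with hj | hj
    · have h2 : α = ((η : K) ^ i) ^ 2 := by rw [← h1, ← hcoe, ← hτ, hj]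
      have h3 := congrArg (Algebra.norm ℚ) h2
      rw [hnorm, map_pow] at h3
      nlinarith [sq_nonneg (Algebra.norm ℚ ((η : K) ^ i))]
    · have h2 : -α = ((η : K) ^ i) ^ 2 := by
        rw [← h1, ← hcoe, ← hτ, hj]; simp
      exact neg_root_ne_sq hα hb _ h2
  obtain ⟨k, hk⟩ := hη u
  have hη0 : (η : K) ≠ 0 := Units.coe_ne_zero η
  rcases Int.even_or_odd k with ⟨i, rfl⟩ | hkodd
  · refine ⟨η ^ i, ?_⟩
    have h1 : (η : K) ^ (i + i) = ((η : K) ^ i) ^ 2 := by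
      rw [zpow_add₀ hη0, sq]
    rcases hk with hk | hk
    · left; rw [hk, hcoe, hcoe, h1]
    · right; left; rw [hk, hcoe, ← h1, ← hcoe]; simp
  · obtain ⟨i, hi⟩ := hkodd.sub_odd hodd
    refine ⟨η ^ i, ?_⟩
    have h1 : (η : K) ^ k = (η : K) ^ j * ((η : K) ^ i) ^ 2 := by
      rw [sq, ← zpow_add₀ hη0, ← zpow_add₀ hη0]; congr 1; omega
    have h2 : α = (η : K) ^ j ∨ α = -(η : K) ^ j := by
      rcases hj with hj | hj
      · left; rw [← hcoe, ← hj, hτ]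
      · right; rw [← hcoe, ← hτ, hj]; simp
    have h3 : (u : K) = (η : K) ^ k ∨ (u : K) = -(η : K) ^ k := by
      rcases hk with hk | hk
      · left; rw [hk, hcoe]
      · right; rw [hk, ← hcoe]; simp
    right; right
    rw [hcoe]
    rcases h2 with h2 | h2 <;> rcases h3 with h3 | h3 <;> rw [h3, h1]
    · right; rw [h2]
    · left; rw [h2]; ring
    · left; rw [h2]; ring
    · right; rw [h2]; ring

/-- The prime 2 is totally ramified, with `1 + α` of norm `-2` above it, so an element of norm `±2 ^
i` is an associate of `(1 + α) ^ i`. -/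
theorem associated_sq_of_dvd_of_norm (hα : α ^ 3 = -α ^ 2 + α - 1)
    {b : Basis (Fin 3) ℚ K} (hb : ∀ i, b i = α ^ (i : ℕ)) {d : 𝓞 K} {j : ℕ}
    (hd : (Algebra.norm ℤ d).natAbs = 2 ^ (2 * j)) : ∃ s : 𝓞 K, Associated d (s ^ 2) := by
  let a : 𝓞 K := ⟨α, isIntegral_root hα⟩
  have ha3 : a ^ 3 = -a ^ 2 + a - 1 := RingOfIntegers.coe_injective hα
  have hnormπ : Algebra.norm ℤ (1 + a) = -2 := by
    have := norm_coords hα hb 1 1 0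
    norm_num at this
    have h2 := Algebra.coe_norm_int (1 + a)
    rw [show ((1 + a : 𝓞 K) : K) = 1 + α from rfl, this] at h2
    exact_mod_cast h2
  have hπ0 : 1 + a ≠ 0 := by
    intro h; rw [h] at hnormπ; simp at hnormπ
  have hπ : Prime (1 + a) := by
    apply Ideal.prime_of_irreducible_absNorm_span hπ0
    rw [Ideal.absNorm_span_singleton, hnormπ]
    exact Nat.prime_two
  have h2 : (2 : 𝓞 K) ∣ (1 + a) ^ 3 := ⟨a * (a + 2), by linear_combination ha3⟩
  have hdvd : d ∣ (1 + a) ^ (3 * (2 * j)) := by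
    have h3 : d ∣ (((2 ^ (2 * j) : ℕ)) : 𝓞 K) := by
      rw [← hd, ← Ideal.absNorm_span_singleton, ← Ideal.mem_span_singleton]
      exact Ideal.absNorm_mem _
    push_cast at h3
    rw [pow_mul]
    exact h3.trans (pow_dvd_pow_of_dvd h2 _)
  obtain ⟨i, -, hi⟩ := (dvd_prime_pow hπ _).1 hdvd
  have hn : (Algebra.norm ℤ d).natAbs = 2 ^ i := by
    have := (hi.map (Algebra.norm ℤ))
    rw [map_pow, hnormπ] at this
    rw [Int.natAbs_eq_iff_associated.2 this]; simp
  have hij : i = 2 * j := Nat.pow_right_injective le_rfl (hn.symm.trans hd)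
  exact ⟨(1 + a) ^ j, by rwa [← pow_mul, mul_comm, ← hij]⟩

/-- A factor of a square in `𝓞 K` whose common divisors with the cofactor have norm dividing
`2 ^ m * 11` is, if its norm is a square, a square times `1` or `-α`. -/
theorem sq_or_neg_root_mul_sq (hα : α ^ 3 = -α ^ 2 + α - 1)
    {b : Basis (Fin 3) ℚ K} (hb : ∀ i, b i = α ^ (i : ℕ)) {A G c : 𝓞 K} {n : ℤ} {m : ℕ}
    (hn : n ≠ 0) (h : A * G = c ^ 2) (hA : Algebra.norm ℤ A = n ^ 2)
    (hdvd : ∀ d : 𝓞 K, d ∣ A → d ∣ G → Algebra.norm ℤ d ∣ 2 ^ m * 11) :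
    ∃ γ : K, (A : K) = γ ^ 2 ∨ (A : K) = -α * γ ^ 2 := by
  have := isPrincipalIdealRing_integers hα hb
  have hA0 : A ≠ 0 := by
    rintro rfl
    rw [Algebra.norm_zero] at hA
    exact pow_ne_zero 2 hn hA.symm
  obtain ⟨d, t, u, hdA, hdG, hAe⟩ := exists_eq_unit_mul_mul_sq hA0 h
  have ht : t ≠ 0 := by rintro rfl; simp at hAe; exact hA0 hAe
  have h1 : (Algebra.norm ℤ d).natAbs * (Algebra.norm ℤ t).natAbs ^ 2 = n.natAbs ^ 2 := by
    rw [← Int.natAbs_pow n, ← hA, hAe, map_mul, map_mul, Int.natAbs_mul, Int.natAbs_mul,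
      norm_unit_natAbs, one_mul, map_pow, Int.natAbs_pow]
  have h2 := hdvd d hdA hdG
  rw [← Int.natAbs_dvd_natAbs] at h2
  obtain ⟨j, hj⟩ := exists_even_pow_of_sq_dvd (m := m)
    (by rw [Int.natAbs_ne_zero]; exact Algebra.norm_ne_zero_iff.2 ht) h1
    (by simpa [Int.natAbs_mul, Int.natAbs_pow] using h2)
  obtain ⟨s, u', hs⟩ := associated_sq_of_dvd_of_norm hα hb hj
  have hd : d = (u'⁻¹ : (𝓞 K)ˣ) * s ^ 2 := by rw [← hs, mul_comm, mul_assoc, Units.mul_inv, mul_one]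
  obtain ⟨μ, hμ⟩ := exists_units_eq_zpow_mul_sq hα hb (u * u'⁻¹)
  have hAK : (A : K) = ((u * u'⁻¹ : (𝓞 K)ˣ) : K) * (s * t : K) ^ 2 := by
    rw [hAe, hd]; push_cast; ring
  have hnA : 0 < Algebra.norm ℚ (A : K) := by
    rw [← Algebra.coe_norm_int, hA]; positivity
  have hnorm : Algebra.norm ℚ α = -1 := by
    have := norm_coords hα hb 0 1 0
    norm_num at this; exact this
  have hneg : Algebra.norm ℚ (-1 : K) = -1 := by
    have := norm_coords hα hb (-1) 0 0
    norm_num at this; exact this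
  refine ⟨μ * (s * t), ?_⟩
  -- The classes of `-1` and `α` are excluded because both have norm `-1`, while `A` has positive
  -- norm.
  rcases hμ with hμ | hμ | hμ | hμ <;> rw [hμ] at hAK
  · left; rw [hAK]; ring
  · exfalso
    rw [show -(μ : K) ^ 2 * (s * t : K) ^ 2 = (-1) * (μ * (s * t) : K) ^ 2 by ring] at hAK
    rw [hAK, map_mul, hneg, map_pow] at hnA
    nlinarith [sq_nonneg (Algebra.norm ℚ (μ * (s * t) : K))]
  · right; rw [hAK]; ring
  · exfalso
    rw [show α * (μ : K) ^ 2 * (s * t : K) ^ 2 = α * (μ * (s * t) : K) ^ 2 by ring] at hAK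
    rw [hAK, map_mul, hnorm, map_pow] at hnA
    nlinarith [sq_nonneg (Algebra.norm ℚ (μ * (s * t) : K))]

end SquareClass

theorem exists_tribonacci_field : ∃ (K : Type) (_ : Field K) (_ : NumberField K) (α : K)
    (b : Basis (Fin 3) ℚ K), α ^ 3 = -α ^ 2 + α - 1 ∧ ∀ i, b i = α ^ (i : ℕ) := by
  let f : Polynomial ℤ := .X ^ 3 + .X ^ 2 - .X + 1
  have hfm : f.Monic := by unfold f; monicity!
  have hdeg : f.natDegree = 3 := by unfold f; compute_degree!
  have hirr : Irreducible f := by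
    -- A cubic without roots modulo 3 is irreducible modulo 3.
    have key : ∀ x : ZMod 3, x ^ 3 + x ^ 2 - x + 1 ≠ 0 := by decide
    have : Fact (Nat.Prime 3) := ⟨Nat.prime_three⟩
    apply hfm.irreducible_of_irreducible_map (Int.castRingHom (ZMod 3))
    have hd : (f.map (Int.castRingHom (ZMod 3))).natDegree = 3 := by
      rw [hfm.natDegree_map, hdeg]
    rw [Polynomial.irreducible_iff_roots_eq_zero_of_degree_le_three (by omega) (by omega)]
    rw [Multiset.eq_zero_iff_forall_notMem]
    intro x hx
    have hr := (Polynomial.mem_roots'.1 hx).2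
    simp only [f, Polynomial.IsRoot.def, Polynomial.map_add, Polynomial.map_sub,
      Polynomial.map_pow, Polynomial.map_X, Polynomial.map_one, Polynomial.eval_add,
      Polynomial.eval_sub, Polynomial.eval_pow, Polynomial.eval_X, Polynomial.eval_one] at hr
    exact key x hr
  let g : Polynomial ℚ := f.map (Int.castRingHom ℚ)
  have hgm : g.Monic := hfm.map _
  have hgd : g.natDegree = 3 := by rw [← hdeg]; exact hfm.natDegree_map _
  have hg : Irreducible g := hfm.irreducible_iff_irreducible_map_fraction_map.1 hirr
  have : Fact (Irreducible g) := ⟨hg⟩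
  let B := (AdjoinRoot.powerBasis hg.ne_zero)
  have hdim : B.dim = 3 := hgd
  have hfin : FiniteDimensional ℚ (AdjoinRoot g) := B.finite
  have hnf : NumberField (AdjoinRoot g) := @NumberField.mk _ _ inferInstance (by convert hfin)
  refine ⟨AdjoinRoot g, inferInstance, hnf, AdjoinRoot.root g, B.basis.reindex (finCongr hdim), ?_, ?_⟩
  · have h := AdjoinRoot.eval₂_root g
    simp [g, f] at h
    linear_combination h
  · intro i
    simp [B]

/-! ### Descent: every rational point is a double -/

/-- If `X = a/d` in lowest terms, then `d` times the homogenised cubic is a square, and these two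
factors are coprime, so each is a square up to sign. Positivity of `d` settles the signs. -/
theorem exists_coprime_of_monic_cubic {p q r : ℤ} {X Y : ℚ}
    (h : Y ^ 2 = X ^ 3 + p * X ^ 2 + q * X + r) : ∃ a e c : ℤ, e ≠ 0 ∧ IsCoprime a e ∧
      X = a / e ^ 2 ∧ c ^ 2 = a ^ 3 + p * a ^ 2 * e ^ 2 + q * a * e ^ 4 + r * e ^ 6 := by
  obtain ⟨a, d, hd, hcop, rfl⟩ : ∃ a d : ℤ, 0 < d ∧ IsCoprime a d ∧ X = a / d :=
    ⟨X.num, X.den, by exact_mod_cast X.den_pos,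
      by rw [Int.isCoprime_iff_gcd_eq_one]; exact X.reduced, (Rat.num_div_den X).symm⟩
  have hd0 : (d : ℚ) ≠ 0 := by exact_mod_cast hd.ne'
  have hsq : IsSquare (d * (a ^ 3 + p * a ^ 2 * d + q * a * d ^ 2 + r * d ^ 3)) := by
    rw [← Rat.isSquare_intCast_iff]
    refine ⟨Y * d ^ 2, ?_⟩
    rw [← sq, mul_pow, h]
    push_cast
    field_simp
  obtain ⟨c, hc⟩ := hsq
  have hcop2 : IsCoprime d (a ^ 3 + p * a ^ 2 * d + q * a * d ^ 2 + r * d ^ 3) := by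
    have h1 : IsCoprime d (a ^ 3) := hcop.symm.pow_right
    rw [show a ^ 3 + p * a ^ 2 * d + q * a * d ^ 2 + r * d ^ 3 =
      a ^ 3 + d * (p * a ^ 2 + q * a * d + r * d ^ 2) by ring]
    exact h1.add_mul_left_right _
  obtain ⟨e, he⟩ := Int.sq_of_isCoprime hcop2 (hc.trans (sq c).symm)
  obtain ⟨c', hc'⟩ := Int.sq_of_isCoprime hcop2.symm (by rw [mul_comm, hc, sq])
  have hde : d = e ^ 2 := by
    rcases he with he | he
    · exact he
    · nlinarith [sq_nonneg e]
  have he0 : e ≠ 0 := by rintro rfl; simp at hde; omega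
  subst hde
  have hpos : 0 ≤ a ^ 3 + p * a ^ 2 * e ^ 2 + q * a * (e ^ 2) ^ 2 + r * (e ^ 2) ^ 3 := by
    by_contra hneg
    nlinarith [mul_self_nonneg c]
  refine ⟨a, e, c', he0, (IsCoprime.pow_right_iff two_pos).1 hcop, by push_cast; rfl, ?_⟩
  rcases hc' with hc' | hc'
  · rw [← hc']; ring
  · have : c' ^ 2 = 0 := by nlinarith [sq_nonneg c']
    rw [this]; rw [this] at hc'; linarith

section Halving

variable {K : Type*} [Field K] [NumberField K] {α : K}

/-- If `X - β` is a square then `X` is the abscissa of a double: multiplying its root by a suitable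
`s - β` makes it linear in `β`, and that linear form is the tangent line at the half point, of
abscissa `s`. -/
theorem exists_half_of_sq {β γ : K} {p q r X u v w : ℚ}
    (hβ : β ^ 3 + p * β ^ 2 + q * β + r = 0)
    (hli : ∀ u v w : ℚ, (u : K) + v * β + w * β ^ 2 = 0 → u = 0 ∧ v = 0 ∧ w = 0)
    (hγ : γ = u + v * β + w * β ^ 2) (h : (X : K) - β = γ ^ 2) :
    ∃ s y : ℚ, y ^ 2 = s ^ 3 + p * s ^ 2 + q * s + r ∧
      4 * (s ^ 3 + p * s ^ 2 + q * s + r) * X =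
        s ^ 4 - 2 * q * s ^ 2 - 8 * r * s + q ^ 2 - 4 * p * r := by
  have hw : w ≠ 0 := by
    rintro rfl
    obtain ⟨h0, h1, h2⟩ := hli (u ^ 2 - X) (2 * u * v + 1) (v ^ 2) (by
      push_cast at hγ ⊢
      rw [hγ] at h
      linear_combination -h)
    have : v = 0 := by simpa using h2
    rw [this] at h1; norm_num at h1
  set s : ℚ := v / w - p with hs
  have hsw : s * w - v + w * p = 0 := by rw [hs]; field_simp; ring
  have hswK : (s : K) * w - v + w * p = 0 := by exact_mod_cast hsw
  set g : ℚ := s * u + w * r with hg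
  set l : ℚ := s * v - u + w * q with hl
  have hlin : ((s : K) - β) * γ = (g : K) + (l : K) * β := by
    rw [hγ, hg, hl]; push_cast
    linear_combination β ^ 2 * hswK - (w : K) * hβ
  -- With `f` the cubic, comparing coefficients gives `f(T) - (g + lT)² = (T - s)²(T - X)`: the line
  -- is tangent at `s` and passes through abscissa `X`.
  obtain ⟨h0, h1, h2⟩ := hli (s ^ 2 * X + r - g ^ 2) (-(s ^ 2 + 2 * s * X) + q - 2 * g * l)
    (X + 2 * s + p - l ^ 2) (by
      push_cast
      linear_combination ((s : K) - β) ^ 2 * h + (((s : K) - β) * γ + (g + l * β)) * hlin + hβ)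
  refine ⟨s, g + l * s, by linear_combination -h0 - s * h1 - s ^ 2 * h2, ?_⟩
  have h3 : 2 * l * (g + l * s) = 3 * s ^ 2 + 2 * p * s + q := by
    linear_combination -h1 - 2 * s * h2
  have h4 : (g + l * s) ^ 2 = s ^ 3 + p * s ^ 2 + q * s + r := by
    linear_combination -h0 - s * h1 - s ^ 2 * h2
  rw [← h4]
  linear_combination 4 * (g + l * s) ^ 2 * h2 - 4 * (2 * s + p) * h4 +
    (2 * l * (g + l * s) + (3 * s ^ 2 + 2 * p * s + q)) * h3

/-- For a point `(a / e², c / e³)` on `Y² = X³ + pX² + qX + r` and a root `β` of the cubic,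
`a - βe²` is a square in the cubic field up to the unit `-α`. -/
theorem sq_or_neg_root_mul_sq_of_point (hα : α ^ 3 = -α ^ 2 + α - 1)
    {b : Basis (Fin 3) ℚ K} (hb : ∀ i, b i = α ^ (i : ℕ)) {β : K} {p q r a e c D : ℤ} {m : ℕ}
    (hint : IsIntegral ℤ β) (hβ : β ^ 3 + p * β ^ 2 + q * β + r = 0)
    (hdisc : Algebra.norm ℚ (3 * β ^ 2 + 2 * p * β + q) = D) (hD : D ∣ 2 ^ m * 11)
    (hcop : IsCoprime a e) (hne : (a : K) - β * e ^ 2 ≠ 0)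
    (h : c ^ 2 = a ^ 3 + p * a ^ 2 * e ^ 2 + q * a * e ^ 4 + r * e ^ 6)
    (hnorm : Algebra.norm ℚ ((a : K) - β * e ^ 2) = c ^ 2) :
    ∃ γ : K, (a : K) - β * e ^ 2 = γ ^ 2 ∨ (a : K) - β * e ^ 2 = -α * γ ^ 2 := by
  obtain ⟨B, hB⟩ : ∃ B : 𝓞 K, (B : K) = β := ⟨⟨β, hint⟩, rfl⟩
  have e2 : ((2 : 𝓞 K) : K) = 2 := map_ofNat _ 2
  have e3 : ((3 : 𝓞 K) : K) = 3 := map_ofNat _ 3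
  have hβ' : B ^ 3 + p * B ^ 2 + q * B + r = 0 := by
    apply RingOfIntegers.coe_injective
    simpa only [map_add, map_mul, map_pow, map_intCast, map_zero, hB] using hβ
  have hdisc' : Algebra.norm ℤ (3 * B ^ 2 + 2 * p * B + q) = D := by
    have h2 := Algebra.coe_norm_int (3 * B ^ 2 + 2 * (p : 𝓞 K) * B + (q : 𝓞 K))
    simp only [map_add, map_mul, map_pow, map_intCast, hB, e2, e3, hdisc] at h2
    exact_mod_cast h2
  have hcoe : (((a : 𝓞 K) - B * e ^ 2 : 𝓞 K) : K) = a - β * e ^ 2 := by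
    simp only [map_sub, map_mul, map_pow, map_intCast, hB]
  have hnorm' : Algebra.norm ℤ ((a : 𝓞 K) - B * e ^ 2) = c ^ 2 := by
    have h2 := Algebra.coe_norm_int ((a : 𝓞 K) - B * (e : 𝓞 K) ^ 2)
    rw [hcoe, hnorm] at h2
    exact_mod_cast h2
  have hc : c ≠ 0 := by
    rintro rfl
    exact hne ((Algebra.norm_eq_zero_iff (R := ℚ)).1 (by rw [hnorm]; simp))
  have hmul : ((a : 𝓞 K) - B * e ^ 2) *
      (a ^ 2 + (B + p) * a * e ^ 2 + (B ^ 2 + p * B + q) * e ^ 4) = (c : 𝓞 K) ^ 2 := by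
    have h' : (c : 𝓞 K) ^ 2 = a ^ 3 + p * a ^ 2 * e ^ 2 + q * a * e ^ 4 + r * e ^ 6 := by
      exact_mod_cast congrArg (Int.cast : ℤ → 𝓞 K) h
    rw [h']; linear_combination (-(e : 𝓞 K) ^ 6) * hβ'
  have hcopK : IsCoprime (a : 𝓞 K) (e : 𝓞 K) := hcop.intCast
  have hcop2 : IsCoprime ((a : 𝓞 K) - B * e ^ 2) ((e : 𝓞 K) ^ 4) := by
    refine IsCoprime.pow_right ?_
    rw [show (a : 𝓞 K) - B * e ^ 2 = a + e * (-(B * e)) by ring]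
    exact hcopK.add_mul_left_left _
  -- A common divisor of `a - βe²` and its cofactor divides `f'(β)e⁴`; being coprime to `e`, it
  -- divides `f'(β)`, whose norm is `D`.
  obtain ⟨γ, hγ⟩ := sq_or_neg_root_mul_sq hα hb hc hmul hnorm' (m := m) (fun d hd1 hd2 => by
    refine (map_dvd (Algebra.norm ℤ) ?_).trans (hdisc' ▸ hD)
    have h1 : d ∣ (3 * B ^ 2 + 2 * p * B + q) * (e : 𝓞 K) ^ 4 := by
      have := dvd_sub hd2 (hd1.mul_right (a + (2 * B + p) * (e : 𝓞 K) ^ 2))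
      rw [show (3 * B ^ 2 + 2 * p * B + q) * (e : 𝓞 K) ^ 4 =
        a ^ 2 + (B + p) * a * e ^ 2 + (B ^ 2 + p * B + q) * e ^ 4 -
        (a - B * e ^ 2) * (a + (2 * B + p) * (e : 𝓞 K) ^ 2) by ring]
      exact this
    exact (hcop2.of_isCoprime_of_dvd_left hd1).dvd_of_dvd_mul_right h1)
  exact ⟨γ, by rwa [hcoe] at hγ⟩

end Halving

/-- Every rational point of `Y² = X³ + 2X² - 4X + 8` is the double of a rational point. -/
theorem exists_half_of_conductor_eleven {X Y : ℚ} (h : Y ^ 2 = X ^ 3 + 2 * X ^ 2 - 4 * X + 8) :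
    ∃ s y : ℚ, y ^ 2 = s ^ 3 + 2 * s ^ 2 - 4 * s + 8 ∧
      4 * (s ^ 3 + 2 * s ^ 2 - 4 * s + 8) * X = s ^ 4 + 8 * s ^ 2 - 64 * s - 48 := by
  obtain ⟨K, _, _, α, b, hα, hb⟩ := exists_tribonacci_field
  obtain ⟨a, e, c, he, hcop, rfl, hc⟩ := exists_coprime_of_monic_cubic (p := 2) (q := -4) (r := 8)
    (X := X) (Y := Y) (by push_cast; linear_combination h)
  have he' : (e : ℚ) ≠ 0 := by exact_mod_cast he
  have heK : (e : K) ≠ 0 := by exact_mod_cast he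
  have hcoe : (a : K) - (2 * α) * e ^ 2 =
      ((a : ℚ) : K) + ((-2 * e ^ 2 : ℚ) : K) * α + ((0 : ℚ) : K) * α ^ 2 := by
    push_cast; ring
  obtain ⟨γ, hγ⟩ := sq_or_neg_root_mul_sq_of_point hα hb (β := 2 * α) (m := 8) (D := 2816)
    (by rw [two_mul]; exact (isIntegral_root hα).add (isIntegral_root hα))
    (by push_cast; linear_combination 8 * hα)
    (by
      have h3 := norm_coords hα hb (-4) 8 12
      norm_num at h3 ⊢
      rw [← h3]; congr 1; ring)
    (by norm_num) hcop
    (by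
      rw [hcoe]
      intro h0
      have := (coords_inj hb (u' := 0) (v' := 0) (w' := 0) (h0.trans (by simp))).2.1
      exact he' (by simpa using this))
    hc
    (by
      have h3 := congrArg (Int.cast : ℤ → ℚ) hc
      push_cast at h3
      rw [hcoe, norm_coords hα hb, h3]; ring)
  rcases hγ with hγ | hγ
  · obtain ⟨u, v, w, huvw⟩ := exists_coords hb (γ / e)
    have := exists_half_of_sq (β := 2 * α) (γ := γ / e) (p := 2) (q := -4) (r := 8)
      (X := a / e ^ 2) (u := u) (v := v / 2) (w := w / 4)
      (by push_cast; linear_combination 8 * hα)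
      (fun u v w h => by
        have := coords_inj hb (u := u) (v := 2 * v) (w := 4 * w) (u' := 0) (v' := 0) (w' := 0)
          (by push_cast; linear_combination h)
        simpa using this)
      (by rw [huvw]; push_cast; ring)
      (by push_cast; rw [div_pow, ← hγ]; field_simp)
    obtain ⟨s, y, h1, h2⟩ := this
    exact ⟨s, y, by linear_combination h1, by linear_combination h2⟩
  · exfalso
    obtain ⟨u, v, w, rfl⟩ := exists_coords hb γ
    rw [neg_root_mul_sq_coords hα, hcoe] at hγ
    obtain ⟨-, h1, h2⟩ := coords_inj hb hγ
    exact no_solution_twisted_double u v w e he h2.symm (by linarith)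

/-- Every rational point of `Y² = X³ + X² + 3X - 1` is the double of a rational point. -/
theorem exists_half_of_conductor_forty_four {X Y : ℚ} (h : Y ^ 2 = X ^ 3 + X ^ 2 + 3 * X - 1) :
    ∃ s y : ℚ, y ^ 2 = s ^ 3 + s ^ 2 + 3 * s - 1 ∧
      4 * (s ^ 3 + s ^ 2 + 3 * s - 1) * X = s ^ 4 - 6 * s ^ 2 + 8 * s + 13 := by
  obtain ⟨K, _, _, α, b, hα, hb⟩ := exists_tribonacci_field
  obtain ⟨a, e, c, he, hcop, rfl, hc⟩ := exists_coprime_of_monic_cubic (p := 1) (q := 3) (r := -1)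
    (X := X) (Y := Y) (by push_cast; linear_combination h)
  have he' : (e : ℚ) ≠ 0 := by exact_mod_cast he
  have heK : (e : K) ≠ 0 := by exact_mod_cast he
  -- Here `β = -α² - 2α = α⁻²`, in accordance with the substitution `X = 1/x²`.
  have hβ2 : (-α ^ 2 - 2 * α) ^ 2 = 2 * α ^ 2 + 2 * α - 3 := by
    linear_combination (α + 3) * hα
  have hβ3 : (-α ^ 2 - 2 * α) ^ 3 + (-α ^ 2 - 2 * α) ^ 2 + 3 * (-α ^ 2 - 2 * α) - 1 = 0 := by
    rw [show (-α ^ 2 - 2 * α) ^ 3 = (-α ^ 2 - 2 * α) ^ 2 * (-α ^ 2 - 2 * α) by ring, hβ2]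
    linear_combination (-2 * α - 4) * hα
  have hcoe : (a : K) - (-α ^ 2 - 2 * α) * e ^ 2 =
      ((a : ℚ) : K) + ((2 * e ^ 2 : ℚ) : K) * α + ((e ^ 2 : ℚ) : K) * α ^ 2 := by
    push_cast; ring
  have hint := isIntegral_root hα
  obtain ⟨γ, hγ⟩ := sq_or_neg_root_mul_sq_of_point hα hb (β := -α ^ 2 - 2 * α) (m := 4) (D := 176)
    (by rw [two_mul]; exact (hint.pow 2).neg.sub (hint.add hint))
    (by push_cast; linear_combination hβ3)
    (by
      have h3 := norm_coords hα hb (-6) 2 4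
      rw [hβ2]
      norm_num at h3 ⊢
      rw [← h3]; congr 1; ring)
    (by norm_num) hcop
    (by
      rw [hcoe]
      intro h0
      have := (coords_inj hb (u' := 0) (v' := 0) (w' := 0) (h0.trans (by simp))).2.1
      exact he' (by simpa using this))
    hc
    (by
      have h3 := congrArg (Int.cast : ℤ → ℚ) hc
      push_cast at h3
      rw [hcoe, norm_coords hα hb, h3]; ring)
  rcases hγ with hγ | hγ
  · obtain ⟨u, v, w, huvw⟩ := exists_coords hb (γ / e)
    -- The values of `u`, `v`, `w` are the coordinates of `γ / e` converted from `1, α, α²` to `1,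
    -- β, β²`.
    have := exists_half_of_sq (β := -α ^ 2 - 2 * α) (γ := γ / e) (p := 1) (q := 3) (r := -1)
      (X := a / e ^ 2) (u := u - 3 / 2 * v + 3 * w) (v := w - v) (w := w - v / 2)
      (by push_cast; linear_combination hβ3)
      (fun u v w h => by
        obtain ⟨h0, h1, h2⟩ := coords_inj hb (u := u - 3 * w) (v := -2 * v + 2 * w)
          (w := -v + 2 * w) (u' := 0) (v' := 0) (w' := 0)
          (by push_cast; linear_combination h - (w : K) * hβ2)
        exact ⟨by linarith, by linarith, by linarith⟩)
      (by rw [huvw]; push_cast; rw [hβ2]; ring)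
      (by push_cast; rw [div_pow, ← hγ]; field_simp)
    obtain ⟨s, y, h1, h2⟩ := this
    exact ⟨s, y, by linear_combination h1, by linear_combination h2⟩
  · exfalso
    obtain ⟨u, v, w, rfl⟩ := exists_coords hb γ
    rw [neg_root_mul_sq_coords hα, hcoe] at hγ
    obtain ⟨-, h1, h2⟩ := coords_inj hb hγ
    exact no_solution_twisted_inv_sq u v w e he h2.symm (by linarith)

/-! ### Heights and the rational points of the two elliptic curves -/

theorem abs_cubic_form_le {m q H : ℤ} (hm : |m| ≤ H) (hq : |q| ≤ H) (a b c d : ℤ) :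
    |a * m ^ 3 + b * m ^ 2 * q + c * m * q ^ 2 + d * q ^ 3| ≤
      (|a| + |b| + |c| + |d|) * H ^ 3 := by
  have hH : 0 ≤ H := (abs_nonneg m).trans hm
  have h2 : |m| ^ 2 ≤ H ^ 2 := pow_le_pow_left₀ (abs_nonneg _) hm 2
  have h3 : |q| ^ 2 ≤ H ^ 2 := pow_le_pow_left₀ (abs_nonneg _) hq 2
  have t1 : |m ^ 3| ≤ H ^ 3 := by rw [abs_pow]; exact pow_le_pow_left₀ (abs_nonneg _) hm 3
  have t2 : |m ^ 2 * q| ≤ H ^ 3 := by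
    rw [abs_mul, abs_pow, pow_succ H]; exact mul_le_mul h2 hq (abs_nonneg _) (by positivity)
  have t3 : |m * q ^ 2| ≤ H ^ 3 := by
    rw [abs_mul, abs_pow, pow_succ' H]; exact mul_le_mul hm h3 (by positivity) hH
  have t4 : |q ^ 3| ≤ H ^ 3 := by rw [abs_pow]; exact pow_le_pow_left₀ (abs_nonneg _) hq 3
  calc |a * m ^ 3 + b * m ^ 2 * q + c * m * q ^ 2 + d * q ^ 3|
      ≤ |a * m ^ 3| + |b * m ^ 2 * q| + |c * m * q ^ 2| + |d * q ^ 3| := by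
        refine (abs_add_le _ _).trans (add_le_add ((abs_add_le _ _).trans
          (add_le_add (abs_add_le _ _) le_rfl)) le_rfl)
    _ = |a| * |m ^ 3| + |b| * |m ^ 2 * q| + |c| * |m * q ^ 2| + |d| * |q ^ 3| := by
        rw [mul_assoc b, mul_assoc c, abs_mul a, abs_mul b, abs_mul c, abs_mul d]
    _ ≤ |a| * H ^ 3 + |b| * H ^ 3 + |c| * H ^ 3 + |d| * H ^ 3 := by gcongr
    _ = _ := by ring

/-- The height of a value `N(r) / D(r)` of a rational function, given a Bézout identity for the
binary forms `N` and `D`. -/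
theorem pow_four_le_of_bezout {m q N D U V U' V' R S H n d : ℤ} (hmq : IsCoprime m q)
    (hnd : IsCoprime n d) (hd : d ≠ 0) (hH : H = max |m| |q|) (hH0 : 0 < H) (hR : 0 < R)
    (h1 : U * N + V * D = R * m ^ 7) (h2 : U' * N + V' * D = R * q ^ 7)
    (hU : |U| + |V| ≤ S * H ^ 3) (hU' : |U'| + |V'| ≤ S * H ^ 3) (h : D * n = N * d) :
    H ^ 4 ≤ S * max |n| |d| := by
  obtain ⟨g, rfl⟩ : d ∣ D := hnd.symm.dvd_of_dvd_mul_right (Dvd.intro_left N h.symm)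
  obtain rfl : N = n * g := mul_right_cancel₀ hd (by linear_combination -h)
  -- The cancellation `g` in `N / D` divides `R m⁷` and `R q⁷`, hence `R`; the factor `R` then drops
  -- out of the final estimate.
  have hgR : g ∣ R := by
    obtain ⟨x, y, hxy⟩ : IsCoprime (m ^ 7) (q ^ 7) := hmq.pow
    have hm : g ∣ R * m ^ 7 := ⟨U * n + V * d, by linear_combination -h1⟩
    have hq : g ∣ R * q ^ 7 := ⟨U' * n + V' * d, by linear_combination -h2⟩
    have := dvd_add (hm.mul_right x) (hq.mul_right y)
    rwa [show R * m ^ 7 * x + R * q ^ 7 * y = R by linear_combination R * hxy] at this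
  have hg : |g| ≤ R := by
    exact Int.le_of_dvd hR ((abs_dvd g R).2 hgR)
  set t := max |n| |d| with ht
  have ht0 : 0 ≤ t := (abs_nonneg n).trans (le_max_left _ _)
  have key : ∀ x U V : ℤ, U * (n * g) + V * (d * g) = R * x ^ 7 → |U| + |V| ≤ S * H ^ 3 →
      |x| ^ 7 ≤ S * H ^ 3 * t := by
    intro x U V hx hUV
    have h3 : R * |x| ^ 7 ≤ R * (S * H ^ 3 * t) := by
      calc R * |x| ^ 7 = |U * (n * g) + V * (d * g)| := by
            rw [hx, abs_mul, abs_pow, abs_of_pos hR]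
        _ ≤ |U| * (|n| * |g|) + |V| * (|d| * |g|) := by
            refine (abs_add_le _ _).trans_eq ?_
            simp only [abs_mul]
        _ ≤ |U| * (t * R) + |V| * (t * R) := by
            have := le_max_left |n| |d|
            have := le_max_right |n| |d|
            gcongr
        _ = (|U| + |V|) * (t * R) := by ring
        _ ≤ S * H ^ 3 * (t * R) := mul_le_mul_of_nonneg_right hUV (by positivity)
        _ = R * (S * H ^ 3 * t) := by ring
    exact le_of_mul_le_mul_left h3 hR
  have h7 : H ^ 7 ≤ S * H ^ 3 * t := by
    rcases max_choice |m| |q| with hc | hc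
    · rw [show H ^ 7 = |m| ^ 7 by rw [hH, hc]]; exact key m U V h1 hU
    · rw [show H ^ 7 = |q| ^ 7 by rw [hH, hc]]; exact key q U' V' h2 hU'
  refine le_of_mul_le_mul_left (a := H ^ 3) ?_ (by positivity)
  linarith

/-- The height of a rational number. -/
def ratHeight (x : ℚ) : ℤ := max |x.num| |(x.den : ℤ)|

theorem ratHeight_pos (x : ℚ) : 0 < ratHeight x :=
  lt_of_lt_of_le (abs_pos.2 (by exact_mod_cast x.den_ne_zero)) (le_max_right _ _)

theorem isCoprime_num_den (x : ℚ) : IsCoprime x.num x.den := by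
  rw [Int.isCoprime_iff_gcd_eq_one]; exact x.reduced

/-- Descent on the height: if every element of `P` is related to an element of `P` that has smaller
height or lies in `T`, and `T` is closed under the relation, then `P` is contained in `T`. -/
theorem height_descent {P T : ℚ → Prop} {f : ℚ → ℚ → Prop}
    (hf : ∀ x, P x → ∃ r, P r ∧ f r x ∧ (ratHeight x ≤ ratHeight r → T r))
    (hT : ∀ r x, T r → f r x → T x) (x : ℚ) (hx : P x) : T x := by
  have key : ∀ n : ℕ, ∀ x, P x → (ratHeight x).toNat = n → T x := by
    intro n
    induction n using Nat.strong_induction_on with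
    | _ n ih =>
      intro x hx hn
      obtain ⟨r, hr, hrx, h⟩ := hf x hx
      refine hT r x ?_ hrx
      by_cases hle : ratHeight x ≤ ratHeight r
      · exact h hle
      · have := ratHeight_pos r
        exact ih _ (by omega) r hr rfl
  exact key _ x hx rfl

theorem eq_div_of_small_height {B : ℕ} {r : ℚ} (h : ratHeight r ≤ B) :
    ∃ m : ℤ, ∃ q : ℕ, -(B : ℤ) ≤ m ∧ m ≤ B ∧ 0 < q ∧ q ≤ B ∧ m.natAbs.Coprime q ∧ r = m / q := by
  have h1 := (le_max_left _ _).trans h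
  have h2 := (le_max_right _ _).trans h
  rw [abs_le] at h1
  rw [Nat.abs_cast] at h2
  exact ⟨r.num, r.den, h1.1, h1.2, r.den_pos, by exact_mod_cast h2, r.reduced,
    (Rat.num_div_den r).symm⟩

theorem small_points_conductor_eleven : ∀ q ∈ Finset.Icc 1 9, ∀ m ∈ Finset.Icc (-9 : ℤ) 9,
    m.natAbs.Coprime q → IsSquare (2 * q * (m ^ 3 + m ^ 2 * q - m * q ^ 2 + q ^ 3)) →
    m = 1 ∧ q = 1 ∨ m = -1 ∧ q = 1 := by
  decide +kernel

theorem small_points_conductor_forty_four : ∀ q ∈ Finset.Icc 1 19, ∀ m ∈ Finset.Icc (-19 : ℤ) 19,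
    m.natAbs.Coprime q → IsSquare (q * (m ^ 3 + m ^ 2 * q + 3 * m * q ^ 2 - q ^ 3)) →
    m = 1 ∧ q = 1 := by
  decide +kernel

theorem x_eq_of_conductor_eleven {x y : ℚ} (h : y ^ 2 = 2 * (x ^ 3 + x ^ 2 - x + 1)) :
    x = 1 ∨ x = -1 := by
  refine height_descent (P := fun x => ∃ y : ℚ, y ^ 2 = 2 * (x ^ 3 + x ^ 2 - x + 1))
    (T := fun x => x = 1 ∨ x = -1)
    (f := fun r x => 4 * (r ^ 3 + r ^ 2 - r + 1) * x = r ^ 4 + 2 * r ^ 2 - 8 * r - 3)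
    ?_ ?_ x ⟨y, h⟩
  · rintro x ⟨y, h⟩
    obtain ⟨s, z, hz, hs⟩ := exists_half_of_conductor_eleven (X := 2 * x) (Y := 2 * y)
      (by linear_combination 4 * h)
    obtain ⟨r, rfl⟩ : ∃ r, s = 2 * r := ⟨s / 2, by ring⟩
    have hz' : (z / 2) ^ 2 = 2 * (r ^ 3 + r ^ 2 - r + 1) := by linear_combination hz / 4
    have hr : 4 * (r ^ 3 + r ^ 2 - r + 1) * x = r ^ 4 + 2 * r ^ 2 - 8 * r - 3 := by
      linear_combination hs / 16
    refine ⟨r, ⟨z / 2, hz'⟩, hr, fun hle => ?_⟩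
    have hden : (r.den : ℚ) ≠ 0 := by exact_mod_cast r.den_ne_zero
    have hxden : (x.den : ℚ) ≠ 0 := by exact_mod_cast x.den_ne_zero
    -- `N / D` is the duplication formula. The resultant constant is `R = 4 · 44`, four times the
    -- absolute discriminant of the cubic; `S = 958` is the sum of the absolute coefficients of `U`
    -- and `V`, and also bounds that of `U'` and `V'`.
    have hbound := pow_four_le_of_bezout (m := r.num) (q := r.den)
      (N := r.num ^ 4 + 2 * r.num ^ 2 * r.den ^ 2 - 8 * r.num * r.den ^ 3 - 3 * r.den ^ 4)
      (D := 4 * r.den * (r.num ^ 3 + r.num ^ 2 * r.den - r.num * r.den ^ 2 + r.den ^ 3))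
      (R := 176) (S := 958) (H := ratHeight r) (isCoprime_num_den r) (isCoprime_num_den x)
      (by exact_mod_cast x.den_ne_zero) rfl (ratHeight_pos r) (by norm_num)
      (U := 176 * r.num ^ 3 + 100 * r.num ^ 2 * r.den + (-112) * r.num * r.den ^ 2
        + 132 * r.den ^ 3)
      (V := (-25) * r.num ^ 3 + (-35) * r.num ^ 2 * r.den + 279 * r.num * r.den ^ 2
        + 99 * r.den ^ 3)
      (U' := 0 * r.num ^ 3 + 12 * r.num ^ 2 * r.den + 8 * r.num * r.den ^ 2
        + (-20) * r.den ^ 3)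
      (V' := (-3) * r.num ^ 3 + 1 * r.num ^ 2 * r.den + (-5) * r.num * r.den ^ 2
        + 29 * r.den ^ 3) (by ring) (by ring)
      ((add_le_add (abs_cubic_form_le (le_max_left _ _) (le_max_right _ _) _ _ _ _)
        (abs_cubic_form_le (le_max_left _ _) (le_max_right _ _) _ _ _ _)).trans (by
          have := pow_pos (ratHeight_pos r) 3
          rw [← add_mul]; exact mul_le_mul_of_nonneg_right (by norm_num) this.le))
      ((add_le_add (abs_cubic_form_le (le_max_left _ _) (le_max_right _ _) _ _ _ _)
        (abs_cubic_form_le (le_max_left _ _) (le_max_right _ _) _ _ _ _)).trans (by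
          have := pow_pos (ratHeight_pos r) 3
          rw [← add_mul]; exact mul_le_mul_of_nonneg_right (by norm_num) this.le))
      (by
        rw [← Rat.num_div_den r, ← Rat.num_div_den x] at hr
        field_simp at hr
        have : (4 * r.den * (r.num ^ 3 + r.num ^ 2 * r.den - r.num * r.den ^ 2 + r.den ^ 3) * x.num
          : ℚ) = (r.num ^ 4 + 2 * r.num ^ 2 * r.den ^ 2 - 8 * r.num * r.den ^ 3 - 3 * r.den ^ 4) *
            x.den := by linear_combination hr
        exact_mod_cast this)
    -- If halving does not lower the height, then `H³ ≤ 958 < 10³`.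
    have h9 : ratHeight r ≤ (9 : ℕ) := by
      have h0 := ratHeight_pos r
      have h1 : ratHeight r ^ 4 ≤ 958 * ratHeight r := hbound.trans (by
        change 958 * ratHeight x ≤ _; linarith)
      by_contra hlt
      push_cast at hlt
      have h2 : 10 ≤ ratHeight r := by omega
      have h3 : 10 ^ 3 ≤ ratHeight r ^ 3 := pow_le_pow_left₀ (by norm_num) h2 3
      nlinarith
    obtain ⟨m, q, hm1, hm2, hq1, hq2, hmq, rfl⟩ := eq_div_of_small_height h9
    have hq0 : (q : ℚ) ≠ 0 := by exact_mod_cast hq1.ne'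
    have := small_points_conductor_eleven q (Finset.mem_Icc.2 ⟨hq1, hq2⟩) m
      (Finset.mem_Icc.2 ⟨by simpa using hm1, by simpa using hm2⟩) hmq (by
        rw [← Rat.isSquare_intCast_iff]
        refine ⟨z / 2 * q ^ 2, ?_⟩
        rw [← sq, mul_pow, hz']
        push_cast
        field_simp)
    rcases this with ⟨rfl, rfl⟩ | ⟨rfl, rfl⟩ <;> norm_num
  -- In the group of order 5, doubling exchanges the abscissas `1` and `-1`.
  · rintro r x (rfl | rfl) hr
    · right; linarith
    · left; linarith

theorem x_eq_of_conductor_forty_four {x y : ℚ} (h : y ^ 2 = x ^ 3 + x ^ 2 + 3 * x - 1) :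
    x = 1 := by
  refine height_descent (P := fun x => ∃ y : ℚ, y ^ 2 = x ^ 3 + x ^ 2 + 3 * x - 1)
    (T := fun x => x = 1)
    (f := fun r x => 4 * (r ^ 3 + r ^ 2 + 3 * r - 1) * x = r ^ 4 - 6 * r ^ 2 + 8 * r + 13)
    ?_ ?_ x ⟨y, h⟩
  · rintro x ⟨y, h⟩
    obtain ⟨r, z, hz, hr⟩ := exists_half_of_conductor_forty_four h
    refine ⟨r, ⟨z, hz⟩, hr, fun hle => ?_⟩
    have hden : (r.den : ℚ) ≠ 0 := by exact_mod_cast r.den_ne_zero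
    have hxden : (x.den : ℚ) ≠ 0 := by exact_mod_cast x.den_ne_zero
    -- Here `R = 4 · 176`, again four times the absolute discriminant, and `S = 7126` is the
    -- coefficient sum of `U` and `V`; below, `7126 < 20³`.
    have hbound := pow_four_le_of_bezout (m := r.num) (q := r.den)
      (N := r.num ^ 4 - 6 * r.num ^ 2 * r.den ^ 2 + 8 * r.num * r.den ^ 3 + 13 * r.den ^ 4)
      (D := 4 * r.den * (r.num ^ 3 + r.num ^ 2 * r.den + 3 * r.num * r.den ^ 2 - r.den ^ 3))
      (R := 704) (S := 7126) (H := ratHeight r) (isCoprime_num_den r) (isCoprime_num_den x)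
      (by exact_mod_cast x.den_ne_zero) rfl (ratHeight_pos r) (by norm_num)
      (U := 704 * r.num ^ 3 + 428 * r.num ^ 2 * r.den + 1720 * r.num * r.den ^ 2
        + (-564) * r.den ^ 3)
      (V := (-107) * r.num ^ 3 + 733 * r.num ^ 2 * r.den + (-1037) * r.num * r.den ^ 2
        + (-1833) * r.den ^ 3)
      (U' := 0 * r.num ^ 3 + 12 * r.num ^ 2 * r.den + 8 * r.num * r.den ^ 2
        + 44 * r.den ^ 3)
      (V' := (-3) * r.num ^ 3 + 1 * r.num ^ 2 * r.den + 15 * r.num * r.den ^ 2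
        + (-33) * r.den ^ 3) (by ring) (by ring)
      ((add_le_add (abs_cubic_form_le (le_max_left _ _) (le_max_right _ _) _ _ _ _)
        (abs_cubic_form_le (le_max_left _ _) (le_max_right _ _) _ _ _ _)).trans (by
          have := pow_pos (ratHeight_pos r) 3
          rw [← add_mul]; exact mul_le_mul_of_nonneg_right (by norm_num) this.le))
      ((add_le_add (abs_cubic_form_le (le_max_left _ _) (le_max_right _ _) _ _ _ _)
        (abs_cubic_form_le (le_max_left _ _) (le_max_right _ _) _ _ _ _)).trans (by
          have := pow_pos (ratHeight_pos r) 3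
          rw [← add_mul]; exact mul_le_mul_of_nonneg_right (by norm_num) this.le))
      (by
        rw [← Rat.num_div_den r, ← Rat.num_div_den x] at hr
        field_simp at hr
        have : (4 * r.den * (r.num ^ 3 + r.num ^ 2 * r.den + 3 * r.num * r.den ^ 2 - r.den ^ 3)
          * x.num : ℚ) = (r.num ^ 4 - 6 * r.num ^ 2 * r.den ^ 2 + 8 * r.num * r.den ^ 3 +
            13 * r.den ^ 4) * x.den := by linear_combination hr
        exact_mod_cast this)
    have h19 : ratHeight r ≤ (19 : ℕ) := by
      have h0 := ratHeight_pos r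
      have h1 : ratHeight r ^ 4 ≤ 7126 * ratHeight r := hbound.trans (by
        change 7126 * ratHeight x ≤ _; linarith)
      by_contra hlt
      push_cast at hlt
      have h2 : 20 ≤ ratHeight r := by omega
      have h3 : 20 ^ 3 ≤ ratHeight r ^ 3 := pow_le_pow_left₀ (by norm_num) h2 3
      nlinarith
    obtain ⟨m, q, hm1, hm2, hq1, hq2, hmq, rfl⟩ := eq_div_of_small_height h19
    have hq0 : (q : ℚ) ≠ 0 := by exact_mod_cast hq1.ne'
    have := small_points_conductor_forty_four q (Finset.mem_Icc.2 ⟨hq1, hq2⟩) m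
      (Finset.mem_Icc.2 ⟨by simpa using hm1, by simpa using hm2⟩) hmq (by
        rw [← Rat.isSquare_intCast_iff]
        refine ⟨z * q ^ 2, ?_⟩
        rw [← sq, mul_pow, hz]
        push_cast
        field_simp)
    obtain ⟨rfl, rfl⟩ := this
    norm_num
  -- In the group of order 3, doubling is negation and fixes the abscissa.
  · rintro r x rfl hr
    linarith

theorem x_eq_of_even_sextic {x w : ℚ} (h : w ^ 2 = -x ^ 6 + 3 * x ^ 4 + x ^ 2 + 1) :
    x = 0 ∨ x = 1 ∨ x = -1 := by
  by_cases hx : x = 0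
  · exact Or.inl hx
  right
  have := x_eq_of_conductor_forty_four (x := 1 / x ^ 2) (y := w / x ^ 3) (by
    rw [div_pow, h]; field_simp; ring)
  have h1 : x ^ 2 = 1 := by field_simp at this; exact this.symm
  exact sq_eq_sq_iff_eq_or_eq_neg.1 (h1.trans (one_pow 2).symm)

/-! ### Points of `C` over quadratic fields -/

section Quadratic

variable {K : Type*} [Field K] [NumberField K] [Algebra.IsQuadraticExtension ℚ K]

/-- A non-rational element of a quadratic field, together with `1`, spans it. -/
theorem exists_eq_add_mul {x : K} (hx : ∀ r : ℚ, x ≠ r) (y : K) : ∃ p m : ℚ, y = p + m * x := by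
  have hli : LinearIndependent ℚ ![1, x] := by
    rw [LinearIndependent.pair_iff]
    intro s t h
    have ht : t = 0 := by
      by_contra ht
      apply hx (-s / t)
      have htK : (t : K) ≠ 0 := by exact_mod_cast ht
      rw [Algebra.smul_def, Algebra.smul_def] at h
      simp at h
      push_cast; field_simp; linear_combination h
    subst ht
    refine ⟨?_, rfl⟩
    rw [Algebra.smul_def] at h
    simpa using h
  have hspan := hli.span_eq_top_of_card_eq_finrank
    (by simp [Algebra.IsQuadraticExtension.finrank_eq_two ℚ K])
  have hy : y ∈ Submodule.span ℚ (Set.range ![1, x]) := by rw [hspan]; trivial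
  simp only [Matrix.range_cons, Matrix.range_empty, Set.union_empty, Set.singleton_union] at hy
  obtain ⟨p, m, hpm⟩ := Submodule.mem_span_pair.1 hy
  exact ⟨p, m, by rw [← hpm, Algebra.smul_def, Algebra.smul_def]; simp⟩

omit [Algebra.IsQuadraticExtension ℚ K] in
theorem eq_zero_of_add_mul_eq_zero {x : K} (hx : ∀ r : ℚ, x ≠ r) {p m : ℚ}
    (h : (p : K) + m * x = 0) : p = 0 ∧ m = 0 := by
  have hm : m = 0 := by
    by_contra hm
    have hmK : (m : K) ≠ 0 := by exact_mod_cast hm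
    apply hx (-p / m)
    push_cast; field_simp; linear_combination h
  subst hm
  exact ⟨by simpa using h, rfl⟩

/-- The line through a non-rational point of `y² = 2(x³ + x² - x + 1)` over a quadratic field and
its conjugate has rational slope `m` and meets the curve in a third, rational, point. -/
theorem minpoly_of_nonrational_point {x y : K} (hx : ∀ r : ℚ, x ≠ r)
    (h : y ^ 2 = 2 * (x ^ 3 + x ^ 2 - x + 1)) : ∃ m : ℚ,
      (x ^ 2 + ((2 - m ^ 2 / 2 : ℚ) : K) * x + ((1 + m ^ 2 / 2 - 2 * m : ℚ) : K) = 0 ∧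
        (y = m * (x - 1) + 2 ∨ y = -(m * (x - 1) + 2))) ∨
      (x ^ 2 + ((-m ^ 2 / 2 : ℚ) : K) * x + ((-(1 + m ^ 2 / 2 + 2 * m) : ℚ) : K) = 0 ∧
        (y = m * (x + 1) + 2 ∨ y = -(m * (x + 1) + 2))) := by
  obtain ⟨p, m, hy⟩ := exists_eq_add_mul hx y
  obtain ⟨n, t, hx2⟩ := exists_eq_add_mul hx (x ^ 2)
  -- By Vieta, the three abscissas on the line `y = p + mx` sum to `m²/2 - 1`, and `x` and its
  -- conjugate contribute `t`; so `x₀` is the third one.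
  obtain ⟨x₀, hx₀⟩ : ∃ x₀ : ℚ, x₀ = m ^ 2 / 2 - 1 - t := ⟨_, rfl⟩
  have hlin : ((p ^ 2 - 2 + 2 * n * x₀ : ℚ) : K) +
      ((2 * p * m + 2 - 2 * n + 2 * x₀ * t : ℚ) : K) * x = 0 := by
    have hx0K : (x₀ : K) = m ^ 2 / 2 - 1 - t := by rw [hx₀]; push_cast; ring
    push_cast
    rw [hy] at h
    linear_combination h + (2 * x - 2 * x₀) * hx2 + 2 * x ^ 2 * hx0K
  obtain ⟨h0, h1⟩ := eq_zero_of_add_mul_eq_zero hx hlin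
  have hE : (p + m * x₀) ^ 2 = 2 * (x₀ ^ 3 + x₀ ^ 2 - x₀ + 1) := by
    linear_combination h0 + x₀ * h1 - 2 * x₀ ^ 2 * hx₀
  rcases x_eq_of_conductor_eleven hE with rfl | rfl
  · have h4 : (p + m - 2) * (p + m + 2) = 0 := by linear_combination hE
    rcases mul_eq_zero.1 h4 with h4 | h4
    · refine ⟨m, Or.inl ⟨?_, Or.inl ?_⟩⟩
      · obtain rfl : p = 2 - m := by linarith
        obtain rfl : t = m ^ 2 / 2 - 2 := by linarith
        obtain rfl : n = 2 * m - m ^ 2 / 2 - 1 := by linarith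
        rw [hx2]; push_cast; ring
      · have : (p : K) + m - 2 = 0 := by exact_mod_cast h4
        rw [hy]; linear_combination this
    · refine ⟨-m, Or.inl ⟨?_, Or.inr ?_⟩⟩
      · obtain rfl : p = -2 - m := by linarith
        obtain rfl : t = m ^ 2 / 2 - 2 := by linarith
        obtain rfl : n = -2 * m - m ^ 2 / 2 - 1 := by linarith
        rw [hx2]; push_cast; ring
      · have : (p : K) + m + 2 = 0 := by exact_mod_cast h4
        rw [hy]; push_cast; linear_combination this
  · have h4 : (p - m - 2) * (p - m + 2) = 0 := by linear_combination hE
    rcases mul_eq_zero.1 h4 with h4 | h4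
    · refine ⟨m, Or.inr ⟨?_, Or.inl ?_⟩⟩
      · obtain rfl : p = 2 + m := by linarith
        obtain rfl : t = m ^ 2 / 2 := by linarith
        obtain rfl : n = 1 + 2 * m + m ^ 2 / 2 := by linarith
        rw [hx2]; push_cast; ring
      · have : (p : K) - m - 2 = 0 := by exact_mod_cast h4
        rw [hy]; linear_combination this
    · refine ⟨-m, Or.inr ⟨?_, Or.inr ?_⟩⟩
      · obtain rfl : p = m - 2 := by linarith
        obtain rfl : t = m ^ 2 / 2 := by linarith
        obtain rfl : n = 1 - 2 * m + m ^ 2 / 2 := by linarith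
        rw [hx2]; push_cast; ring
      · have : (p : K) - m + 2 = 0 := by exact_mod_cast h4
        rw [hy]; push_cast; linear_combination this

omit [Algebra.IsQuadraticExtension ℚ K] in
theorem quadratic_coeffs_eq {x : K} (hx : ∀ r : ℚ, x ≠ r) {a b a' b' : ℚ}
    (h : x ^ 2 + (a : K) * x + b = 0) (h' : x ^ 2 + (a' : K) * x + b' = 0) : a = a' ∧ b = b' := by
  have : ((b - b' : ℚ) : K) + ((a - a' : ℚ) : K) * x = 0 := by
    push_cast; linear_combination h - h'
  obtain ⟨h1, h2⟩ := eq_zero_of_add_mul_eq_zero hx this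
  exact ⟨by linarith, by linarith⟩

omit [NumberField K] [Algebra.IsQuadraticExtension ℚ K] in
theorem sq_ne_one_of_nonrational {x : K} (hx : ∀ r : ℚ, x ≠ r) : x ^ 2 ≠ 1 := by
  intro h
  rcases sq_eq_sq_iff_eq_or_eq_neg.1 (h.trans (one_pow 2).symm) with h | h
  · exact hx 1 (by simpa using h)
  · exact hx (-1) (by simpa using h)

/-- Since `(-x, z)` lies on the same elliptic curve as `(x, y)`, there are two descriptions of the
minimal polynomial of `x`. Equating them leaves only `m = n = -2`; every other solution would make
`x² = 1` or `x = ±1`. -/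
theorem nonrational_point_curveC {x y z : K} (hx : ∀ r : ℚ, x ≠ r)
    (hy : y ^ 2 = 2 * (x ^ 3 + x ^ 2 - x + 1)) (hz : z ^ 2 = -2 * (x ^ 3 - x ^ 2 - x - 1)) :
    x ^ 2 + 7 = 0 ∧ (y = 2 * x - 4 ∨ y = -(2 * x - 4)) ∧ (z = 2 * x + 4 ∨ z = -(2 * x + 4)) := by
  have hx' : ∀ r : ℚ, -x ≠ r := fun r h => hx (-r) (by push_cast; rw [← h]; ring)
  have hne := sq_ne_one_of_nonrational hx
  obtain ⟨m, hm⟩ := minpoly_of_nonrational_point hx hy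
  obtain ⟨n, hn⟩ := minpoly_of_nonrational_point hx' (y := z) (by rw [hz]; ring)
  rcases hm with ⟨hm, hym⟩ | ⟨hm, hym⟩ <;> rcases hn with ⟨hn, hzn⟩ | ⟨hn, hzn⟩
  · obtain ⟨h1, h2⟩ := quadratic_coeffs_eq hx hm (a' := -(2 - n ^ 2 / 2))
      (b' := 1 + n ^ 2 / 2 - 2 * n) (by push_cast at hn ⊢; linear_combination hn)
    have h3 : (m - n) * (m + n - 4) = 0 := by linear_combination 2 * h2
    have hmn : m = 2 ∧ n = 2 ∨ m = -2 ∧ n = -2 := by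
      rcases mul_eq_zero.1 h3 with h3 | h3
      · obtain rfl : m = n := by linarith
        have h4 : (m - 2) * (m + 2) = 0 := by linear_combination -h1
        rcases mul_eq_zero.1 h4 with h4 | h4
        · left; constructor <;> linarith
        · right; constructor <;> linarith
      · obtain rfl : n = 4 - m := by linarith
        have h4 : (m - 2) ^ 2 = 0 := by linear_combination -h1
        have h5 : m - 2 = 0 := by simpa using h4
        left; constructor <;> linarith
    rcases hmn with ⟨rfl, rfl⟩ | ⟨rfl, rfl⟩
    · exact absurd (by push_cast at hm; linear_combination hm) hne
    · push_cast at hm hym hzn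
      refine ⟨by linear_combination hm, ?_, ?_⟩
      · rcases hym with h | h
        · right; rw [h]; ring
        · left; rw [h]; ring
      · rcases hzn with h | h
        · left; rw [h]; ring
        · right; rw [h]; ring
  · obtain ⟨h1, h2⟩ := quadratic_coeffs_eq hx hm (a' := -(-n ^ 2 / 2))
      (b' := -(1 + n ^ 2 / 2 + 2 * n)) (by push_cast at hn ⊢; linear_combination hn)
    obtain rfl : n = m - 2 := by linarith
    have h4 : m * (m - 2) = 0 := by linear_combination -h1
    rcases mul_eq_zero.1 h4 with rfl | h4
    · exfalso
      push_cast at hm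
      have : (x + 1) ^ 2 = 0 := by linear_combination hm
      exact hx (-1) (by push_cast; linear_combination (pow_eq_zero_iff two_ne_zero).1 this)
    · obtain rfl : m = 2 := by linarith
      exact absurd (by push_cast at hm; linear_combination hm) hne
  · obtain ⟨h1, h2⟩ := quadratic_coeffs_eq hx hm (a' := -(2 - n ^ 2 / 2))
      (b' := 1 + n ^ 2 / 2 - 2 * n) (by push_cast at hn ⊢; linear_combination hn)
    obtain rfl : m = n - 2 := by linarith
    have h4 : n * (n - 2) = 0 := by linear_combination -h1
    rcases mul_eq_zero.1 h4 with rfl | h4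
    · exfalso
      push_cast at hm
      have : (x - 1) ^ 2 = 0 := by linear_combination hm
      exact hx 1 (by push_cast; linear_combination (pow_eq_zero_iff two_ne_zero).1 this)
    · obtain rfl : n = 2 := by linarith
      exact absurd (by push_cast at hm; linear_combination hm) hne
  · obtain ⟨h1, h2⟩ := quadratic_coeffs_eq hx hm (a' := -(-n ^ 2 / 2))
      (b' := -(1 + n ^ 2 / 2 + 2 * n)) (by push_cast at hn ⊢; linear_combination hn)
    have hm0 : m = 0 := by nlinarith [sq_nonneg m, sq_nonneg n]
    subst hm0
    exact absurd (by push_cast at hm; linear_combination hm) hne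

/-- If `y` is irrational, write `z = p + qy`; as `z²` is rational, `pq = 0`. Then either `z` is
rational, or `z = qy` and `yz` is rational, which gives a point on the even sextic. -/
theorem rational_x_point_curveC {x : ℚ} {y z : K}
    (hy : y ^ 2 = 2 * ((x : K) ^ 3 + x ^ 2 - x + 1))
    (hz : z ^ 2 = -2 * ((x : K) ^ 3 - x ^ 2 - x - 1)) : x = 0 ∨ x = 1 ∨ x = -1 := by
  by_cases hyr : ∃ r : ℚ, y = r
  · obtain ⟨r, rfl⟩ := hyr
    exact Or.inr (x_eq_of_conductor_eleven (x := x) (y := r) (by exact_mod_cast hy))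
  push Not at hyr
  obtain ⟨p, q, hpq⟩ := exists_eq_add_mul hyr z
  have hlin : ((p ^ 2 + q ^ 2 * (2 * (x ^ 3 + x ^ 2 - x + 1)) +
      2 * (x ^ 3 - x ^ 2 - x - 1) : ℚ) : K) + ((2 * p * q : ℚ) : K) * y = 0 := by
    rw [hpq] at hz
    push_cast; linear_combination hz - (q : K) ^ 2 * hy
  obtain ⟨h0, h1⟩ := eq_zero_of_add_mul_eq_zero hyr hlin
  rcases mul_eq_zero.1 h1 with h1 | rfl
  · obtain rfl : p = 0 := by linarith
    refine x_eq_of_even_sextic (x := x) (w := q * (x ^ 3 + x ^ 2 - x + 1)) ?_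
    linear_combination (x ^ 3 + x ^ 2 - x + 1) / 2 * h0
  · have := x_eq_of_conductor_eleven (x := -x) (y := p) (by linear_combination h0)
    rcases this with h | h
    · right; right; linarith
    · right; left; linarith

/-- The points of `C` over a quadratic field. -/
theorem mem_curveC_quadratic {x y z : K}
    (hy : y ^ 2 = 2 * (x ^ 3 + x ^ 2 - x + 1)) (hz : z ^ 2 = -2 * (x ^ 3 - x ^ 2 - x - 1)) :
    ((x = 1 ∨ x = -1) ∧ (y = 2 ∨ y = -2) ∧ (z = 2 ∨ z = -2)) ∨
    (x = 0 ∧ y ^ 2 = 2 ∧ z ^ 2 = 2) ∨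
    (x ^ 2 + 7 = 0 ∧ (y = 2 * x - 4 ∨ y = -(2 * x - 4)) ∧ (z = 2 * x + 4 ∨ z = -(2 * x + 4))) := by
  by_cases hxr : ∃ r : ℚ, x = r
  · obtain ⟨r, rfl⟩ := hxr
    rcases rational_x_point_curveC hy hz with rfl | rfl | rfl
    · right; left
      push_cast at hy hz
      exact ⟨by simp, by rw [hy]; ring, by rw [hz]; ring⟩
    · left
      push_cast at hy hz
      refine ⟨by simp, ?_, ?_⟩ <;> apply sq_eq_sq_iff_eq_or_eq_neg.1
      · rw [hy]; ring
      · rw [hz]; ring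
    · left
      push_cast at hy hz
      refine ⟨by simp, ?_, ?_⟩ <;> apply sq_eq_sq_iff_eq_or_eq_neg.1
      · rw [hy]; ring
      · rw [hz]; ring
  · push Not at hxr
    exact Or.inr (Or.inr (nonrational_point_curveC hxr hy hz))

end Quadratic

/-! ### The fields ℚ(√2) and ℚ(√-7), and the graph 10(1,1)a -/

theorem rat_sq_ne_two (r : ℚ) : r ^ 2 ≠ 2 := by
  intro h
  have h1 : IsSquare ((2 : ℤ) : ℚ) := ⟨r, by rw [← sq, h]; rfl⟩
  rw [Rat.isSquare_intCast_iff] at h1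
  exact absurd h1 (by decide +kernel)

theorem isQuadraticExtension_of_adjoin_sqrt {K : Type*} [Field K] [NumberField K] {d : ℚ} {s : K}
    (hd : ∀ r : ℚ, r ^ 2 ≠ d) (hs : s ^ 2 = algebraMap ℚ K d) (htop : ℚ⟮s⟯ = ⊤) :
    Algebra.IsQuadraticExtension ℚ K := by
  have hirr : Irreducible (.X ^ 2 - .C d : Polynomial ℚ) :=
    X_pow_sub_C_irreducible_of_prime Nat.prime_two hd
  have hmin : minpoly ℚ s = .X ^ 2 - .C d :=
    (minpoly.eq_of_irreducible_of_monic hirr (by simp [hs])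
      (Polynomial.monic_X_pow_sub_C d two_ne_zero)).symm
  have hint : IsIntegral ℚ s := Algebra.IsIntegral.isIntegral s
  have h := IntermediateField.adjoin.finrank hint
  rw [htop, IntermediateField.finrank_top', hmin, Polynomial.natDegree_X_pow_sub_C] at h
  exact ⟨h⟩

section

variable {K : Type*} [Field K] [NumberField K]

theorem adjoin_eq_top_of_nonrational [Algebra.IsQuadraticExtension ℚ K] {s : K}
    (hs : ∀ r : ℚ, s ≠ r) : ℚ⟮s⟯ = ⊤ := by
  rw [eq_top_iff]
  intro y _
  obtain ⟨p, m, rfl⟩ := exists_eq_add_mul hs y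
  have h1 := IntermediateField.mem_adjoin_simple_self ℚ s
  have h2 : ∀ r : ℚ, (r : K) ∈ ℚ⟮s⟯ := fun r => by
    exact ℚ⟮s⟯.algebraMap_mem r
  exact add_mem (h2 p) (mul_mem (h2 m) h1)

theorem nonrational_of_sq {s : K} {d : ℚ} (hd : ∀ r : ℚ, r ^ 2 ≠ d) (hs : s ^ 2 = d) (r : ℚ) :
    s ≠ r := by
  rintro rfl
  exact hd r (by exact_mod_cast hs)

theorem rat_sq_ne_neg_seven (r : ℚ) : r ^ 2 ≠ -7 := by nlinarith [sq_nonneg r]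

/-- `ℚ(√2)` and `ℚ(√-7)` are distinct. -/
theorem not_sqrt_two_and_sqrt_neg_seven [Algebra.IsQuadraticExtension ℚ K] {s t : K}
    (hs : s ^ 2 = 2) (ht : t ^ 2 = -7) : False := by
  have hs' := nonrational_of_sq rat_sq_ne_two (s := s) (by rw [hs]; simp)
  obtain ⟨p, m, rfl⟩ := exists_eq_add_mul hs' t
  have h : ((p ^ 2 + 2 * m ^ 2 + 7 : ℚ) : K) + ((2 * p * m : ℚ) : K) * s = 0 := by
    push_cast; linear_combination ht - (m : K) ^ 2 * hs
  have := (eq_zero_of_add_mul_eq_zero hs' h).1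
  nlinarith [sq_nonneg p, sq_nonneg m]

theorem curveC_rat : curveC ℚ = {p | (p.1 = 1 ∨ p.1 = -1) ∧ (p.2.1 = 2 ∨ p.2.1 = -2) ∧
    (p.2.2 = 2 ∨ p.2.2 = -2)} := by
  ext ⟨x, y, z⟩
  simp only [curveC, Set.mem_ofPred_eq]
  constructor
  · rintro ⟨hy, hz⟩
    refine ⟨x_eq_of_conductor_eleven hy, ?_, ?_⟩ <;> apply sq_eq_sq_iff_eq_or_eq_neg.1 <;>
      rcases x_eq_of_conductor_eleven hy with rfl | rfl
    · rw [hy]; norm_num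
    · rw [hy]; norm_num
    · rw [hz]; norm_num
    · rw [hz]; norm_num
  · rintro ⟨rfl | rfl, rfl | rfl, rfl | rfl⟩ <;> norm_num

theorem mem_rationalPointsC {p : K × K × K} : p ∈ rationalPointsC K ↔
    (p.1 = 1 ∨ p.1 = -1) ∧ (p.2.1 = 2 ∨ p.2.1 = -2) ∧ (p.2.2 = 2 ∨ p.2.2 = -2) := by
  rw [rationalPointsC, curveC_rat]
  obtain ⟨x, y, z⟩ := p
  constructor
  · rintro ⟨⟨a, b, c⟩, ⟨h1, h2, h3⟩, h⟩
    simp only at h1 h2 h3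
    simp only [Prod.mk.injEq] at h
    obtain ⟨rfl, rfl, rfl⟩ := h
    refine ⟨?_, ?_, ?_⟩
    · rcases h1 with rfl | rfl <;> simp
    · rcases h2 with rfl | rfl <;> simp
    · rcases h3 with rfl | rfl <;> simp
  · rintro ⟨h1, h2, h3⟩
    simp only at h1 h2 h3
    obtain ⟨a, ha, rfl⟩ : ∃ a : ℚ, (a = 1 ∨ a = -1) ∧ algebraMap ℚ K a = x := by
      rcases h1 with rfl | rfl
      · exact ⟨1, by simp⟩
      · exact ⟨-1, by simp⟩
    obtain ⟨b, hb, rfl⟩ : ∃ a : ℚ, (a = 2 ∨ a = -2) ∧ algebraMap ℚ K a = y := by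
      rcases h2 with rfl | rfl
      · exact ⟨2, by simp⟩
      · exact ⟨-2, by simp⟩
    obtain ⟨c, hc, rfl⟩ : ∃ a : ℚ, (a = 2 ∨ a = -2) ∧ algebraMap ℚ K a = z := by
      rcases h3 with rfl | rfl
      · exact ⟨2, by simp⟩
      · exact ⟨-2, by simp⟩
    exact ⟨(a, b, c), ⟨ha, hb, hc⟩, rfl⟩

theorem rationalPointsC_subset : rationalPointsC K ⊆ curveC K := by
  rintro ⟨x, y, z⟩ h
  rw [mem_rationalPointsC] at h
  simp only at h
  simp only [curveC, Set.mem_ofPred_eq]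
  rcases h with ⟨rfl | rfl, rfl | rfl, rfl | rfl⟩ <;> norm_num

theorem isRatAdjoinSqrt_two [Algebra.IsQuadraticExtension ℚ K] {s : K} (hs : s ^ 2 = 2) :
    IsRatAdjoinSqrt 2 K :=
  ⟨s, by rw [hs]; simp, adjoin_eq_top_of_nonrational
    (nonrational_of_sq rat_sq_ne_two (by rw [hs]; simp))⟩

theorem isRatAdjoinSqrt_neg_seven [Algebra.IsQuadraticExtension ℚ K] {s : K} (hs : s ^ 2 = -7) :
    IsRatAdjoinSqrt (-7) K :=
  ⟨s, by rw [hs]; simp, adjoin_eq_top_of_nonrational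
    (nonrational_of_sq rat_sq_ne_neg_seven (by rw [hs]; simp))⟩

theorem curveC_eq_rationalPointsC [Algebra.IsQuadraticExtension ℚ K]
    (h2 : ¬ IsRatAdjoinSqrt 2 K) (h7 : ¬ IsRatAdjoinSqrt (-7) K) :
    curveC K = rationalPointsC K := by
  refine Set.Subset.antisymm ?_ rationalPointsC_subset
  rintro ⟨x, y, z⟩ ⟨hy, hz⟩
  rcases mem_curveC_quadratic hy hz with h | ⟨-, h, -⟩ | ⟨h, -⟩
  · exact mem_rationalPointsC.2 h
  · exact absurd (isRatAdjoinSqrt_two h) h2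
  · exact absurd (isRatAdjoinSqrt_neg_seven (eq_neg_of_add_eq_zero_left h)) h7

theorem curveC_sqrt_two {s : K} (hs : s ^ 2 = 2) (htop : ℚ⟮s⟯ = ⊤) :
    curveC K \ rationalPointsC K =
      {p | p.1 = 0 ∧ (p.2.1 = s ∨ p.2.1 = -s) ∧ (p.2.2 = s ∨ p.2.2 = -s)} := by
  have := isQuadraticExtension_of_adjoin_sqrt rat_sq_ne_two (by rw [hs]; simp) htop
  ext ⟨x, y, z⟩
  rw [Set.mem_sdiff, mem_rationalPointsC]
  simp only [curveC, Set.mem_ofPred_eq]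
  constructor
  · rintro ⟨⟨hy, hz⟩, hr⟩
    rcases mem_curveC_quadratic hy hz with h | ⟨h0, h1, h2⟩ | ⟨h, -⟩
    · exact absurd h hr
    · exact ⟨h0, sq_eq_sq_iff_eq_or_eq_neg.1 (h1.trans hs.symm),
        sq_eq_sq_iff_eq_or_eq_neg.1 (h2.trans hs.symm)⟩
    · exact (not_sqrt_two_and_sqrt_neg_seven hs (eq_neg_of_add_eq_zero_left h)).elim
  · rintro ⟨rfl, hy, hz⟩
    have hy2 : y ^ 2 = s ^ 2 := sq_eq_sq_iff_eq_or_eq_neg.2 hy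
    have hz2 : z ^ 2 = s ^ 2 := sq_eq_sq_iff_eq_or_eq_neg.2 hz
    exact ⟨⟨by rw [hy2, hs]; ring, by rw [hz2, hs]; ring⟩, by simp⟩

theorem curveC_sqrt_neg_seven (hK : IsRatAdjoinSqrt (-7) K) :
    curveC K \ rationalPointsC K =
      {p | p.1 ^ 2 + 7 = 0 ∧ (p.2.1 = 2 * p.1 - 4 ∨ p.2.1 = -(2 * p.1 - 4)) ∧
        (p.2.2 = 2 * p.1 + 4 ∨ p.2.2 = -(2 * p.1 + 4))} := by
  obtain ⟨s, hs, htop⟩ := hK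
  have := isQuadraticExtension_of_adjoin_sqrt rat_sq_ne_neg_seven hs htop
  have hs' : s ^ 2 = -7 := by rw [hs]; simp
  ext ⟨x, y, z⟩
  rw [Set.mem_sdiff, mem_rationalPointsC]
  simp only [curveC, Set.mem_ofPred_eq]
  constructor
  · rintro ⟨⟨hy, hz⟩, hr⟩
    rcases mem_curveC_quadratic hy hz with h | ⟨-, h, -⟩ | h
    · exact absurd h hr
    · exact (not_sqrt_two_and_sqrt_neg_seven h hs').elim
    · exact h
  · rintro ⟨h7, hy, hz⟩
    have hy2 := sq_eq_sq_iff_eq_or_eq_neg.2 hy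
    have hz2 := sq_eq_sq_iff_eq_or_eq_neg.2 hz
    refine ⟨⟨by rw [hy2]; linear_combination (2 - 2 * x) * h7,
      by rw [hz2]; linear_combination (2 + 2 * x) * h7⟩, ?_⟩
    rintro ⟨h | h, -⟩ <;> subst h <;> norm_num at h7

/-- With fixed point `p`, the graph forces the vertices `-p`, `±q`, and square roots `r`, `s` of `q
- c`, `-q - c`. For `k = q/p` one finds `p(1 - k²) = 2`, and `(k, s(1 - k²), r(1 - k²))` lies on
`C`. The values `k = 0, ±1` are degenerate, so `k² = -7`, `p = 1/4` and `c = p - p² = 3/16`. -/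
theorem eq_of_containsCopy_graph10 [Algebra.IsQuadraticExtension ℚ K] {c : K}
    (h : (preperiodicGraph (quadMap c)).ContainsCopy graph10_11a) :
    c = 3 / 16 ∧ IsRatAdjoinSqrt (-7) K := by
  obtain ⟨φ, hinj, hφ⟩ := h
  have edge : ∀ i, ((φ i : K)) ^ 2 + c =
      φ ((![0, 0, 1, 1, 2, 2, 3, 3, 8, 8] : Fin 10 → Fin 10) i) := fun i => hφ i _ rfl
  have ne : ∀ {i j : Fin 10}, i ≠ j → (φ i : K) ≠ φ j := fun hij h =>
    hij (hinj (Subtype.ext h))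
  have e0 : (φ 0 : K) ^ 2 + c = φ 0 := edge 0
  have e1 : (φ 1 : K) ^ 2 + c = φ 0 := edge 1
  have e2 : (φ 2 : K) ^ 2 + c = φ 1 := edge 2
  have e3 : (φ 3 : K) ^ 2 + c = φ 1 := edge 3
  have e4 : (φ 4 : K) ^ 2 + c = φ 2 := edge 4
  have e6 : (φ 6 : K) ^ 2 + c = φ 3 := edge 6
  have neg : ∀ {a b : K}, a ≠ b → a ^ 2 = b ^ 2 → b = -a := fun hab h => by
    rcases sq_eq_sq_iff_eq_or_eq_neg.1 h with h | h
    · exact absurd h hab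
    · rw [h, neg_neg]
  have h1 : (φ 1 : K) = -φ 0 := neg (ne (by decide)) (by linear_combination e0 - e1)
  have h3 : (φ 3 : K) = -φ 2 := neg (ne (by decide)) (by linear_combination e2 - e3)
  have h23 : (φ 2 : K) ≠ φ 3 := ne (by decide)
  have h01 : (φ 0 : K) ≠ φ 1 := ne (by decide)
  rw [h1] at e2 h01
  rw [h3] at e6 h23
  generalize (φ 0 : K) = p at *
  generalize (φ 2 : K) = q at *
  generalize (φ 4 : K) = r at *
  generalize (φ 6 : K) = s at *
  have hp : p ≠ 0 := fun h0 => h01 (by rw [h0, neg_zero])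
  have hq : q ≠ 0 := fun h0 => h23 (by rw [h0, neg_zero])
  obtain ⟨k, rfl⟩ : ∃ k, q = k * p := ⟨q / p, by field_simp⟩
  have hk : k ≠ 0 := left_ne_zero_of_mul hq
  have hc : c = p - p ^ 2 := by linear_combination e0
  have hkp : p * (1 - k ^ 2) = 2 := by
    apply mul_left_cancel₀ hp
    rw [hc] at e2; linear_combination -e2
  have hk1 : 1 - k ^ 2 ≠ 0 := right_ne_zero_of_mul (hkp.trans_ne two_ne_zero)
  have hy : (s * (1 - k ^ 2)) ^ 2 = 2 * (k ^ 3 + k ^ 2 - k + 1) := by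
    rw [hc] at e6
    linear_combination (1 - k ^ 2) ^ 2 * e6 +
      (p * (1 - k ^ 2) + 2 - (1 - k ^ 2) * (1 + k)) * hkp
  have hz : (r * (1 - k ^ 2)) ^ 2 = -2 * (k ^ 3 - k ^ 2 - k - 1) := by
    rw [hc] at e4
    linear_combination (1 - k ^ 2) ^ 2 * e4 +
      (p * (1 - k ^ 2) + 2 - (1 - k ^ 2) * (1 - k)) * hkp
  rcases mem_curveC_quadratic hy hz with ⟨h | h, -⟩ | ⟨h, -⟩ | ⟨h, -⟩
  · exact absurd (by rw [h]; ring) hk1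
  · exact absurd (by rw [h]; ring) hk1
  · exact absurd h hk
  · have hk2 : k ^ 2 = -7 := eq_neg_of_add_eq_zero_left h
    refine ⟨?_, isRatAdjoinSqrt_neg_seven hk2⟩
    rw [hk2] at hkp
    have hp4 : p = 1 / 4 := by linear_combination hkp / 8
    rw [hc, hp4]; norm_num

end

theorem mainTheorem5 :
    -- the rational points
    (curveC ℚ = {p | (p.1 = 1 ∨ p.1 = -1) ∧ (p.2.1 = 2 ∨ p.2.1 = -2) ∧
      (p.2.2 = 2 ∨ p.2.2 = -2)}) ∧
    -- quadratic fields other than `ℚ(√2)` and `ℚ(√-7)`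
    (∀ (K : Type*) [Field K] [NumberField K] [Algebra.IsQuadraticExtension ℚ K],
      ¬ IsRatAdjoinSqrt 2 K → ¬ IsRatAdjoinSqrt (-7) K → curveC K = rationalPointsC K) ∧
    -- the field `ℚ(√2)`
    (∀ (K : Type*) [Field K] [NumberField K] (s : K), s ^ 2 = 2 → ℚ⟮s⟯ = ⊤ →
      curveC K \ rationalPointsC K =
        {p | p.1 = 0 ∧ (p.2.1 = s ∨ p.2.1 = -s) ∧ (p.2.2 = s ∨ p.2.2 = -s)}) ∧
    -- the field `ℚ(√-7)`
    (∀ (K : Type*) [Field K] [NumberField K], IsRatAdjoinSqrt (-7) K →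
      curveC K \ rationalPointsC K =
        {p | p.1 ^ 2 + 7 = 0 ∧ (p.2.1 = 2 * p.1 - 4 ∨ p.2.1 = -(2 * p.1 - 4)) ∧
          (p.2.2 = 2 * p.1 + 4 ∨ p.2.2 = -(2 * p.1 + 4))}) ∧
    -- the graph 10(1,1)a over quadratic fields
    (∀ (K : Type*) [Field K] [NumberField K] [Algebra.IsQuadraticExtension ℚ K] (c : K),
      (preperiodicGraph (quadMap c)).ContainsCopy graph10_11a →
        c = 3 / 16 ∧ IsRatAdjoinSqrt (-7) K) :=
  ⟨curveC_rat, fun _ => curveC_eq_rationalPointsC, fun _ _ _ _ => curveC_sqrt_two,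
    fun _ => curveC_sqrt_neg_seven, fun _ _ _ _ _ => eq_of_containsCopy_graph10⟩
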